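/- Let $G$ be a finite group and $R$ a commutative ring with $1$. For a finite group $H$ let $RB(H)=R\otimes_{\mathbb Z}B(H)$ be the Burnside algebra (the Grothendieck ring of finite $H$-sets under disjoint union and product, with scalars extended to $R$). A bilinear form $b$ on an $R$-module $A$ is called non-degenerate if $x\mapsto b(x,-)$ is an isomorphism $A\to \mathrm{Hom}_R(A,R)$. Let $\mu_R(G)$ be the Mackey algebra, i.e. the unital associative $R$-algebra with generators $t_H^K$, $r_H^K$ and $c_{g,H}$ ($H\le K\le G$, $g\in G$) and relations, where ${}^gH=gHg^{-1}$ and $H^g=g^{-1}Hg$: - $\sum_{H\le G}t_H^H=1$, and $t_H^H=r_H^H=c_{h,H}$ for $h\in H$; - $t_K^Lt_H^K=t_H^L$ and $r_H^Kr_K^L=r_H^L$ for $H\le K\le L$; $c_{g',{}^gH}c_{g,H}=c_{g'g,H}$; - $t_{{}^gH}^{{}^gK}c_{g,H}=c_{g,K}t_H^K$ and $r_{{}^gH}^{{}^gK}c_{g,K}=c_{g,H}r_H^K$ for $H\le K$; - $r_L^Ht_K^H=\sum_{h\in[L\backslash H/K]}t^L_{L\cap{}^hK}\,c_{h,L^h\cap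 K}\,r^K_{L^h\cap K}$ for $L,K\le H$; - $ab=0$ for generators $a,b$ such that the source of $a$ is not the target of $b$, where $t_H^K$, $r_H^K$, $c_{g,H}$ go from $H$ to $K$, from $K$ to $H$ and from $H$ to ${}^gH$ respectively. For a finite $G$-set $X$ let $RB(X^2)$ be the Grothendieck group of finite $G$-sets $(X\leftarrow Z\to X)$ over $X\times X$ for disjoint union, with scalars extended to $R$; it is an $R$-algebra, where the product of $(X\leftarrow Y\xrightarrow{\beta}X)$ and $(X\xleftarrow{\gamma}Z\to X)$ is the pullback of $\beta$ and $\gamma$. Let $\Omega=\bigsqcup_{L\le G}G/L$, and let $\beta:\mu_R(G)\to RB(\Omega^2)$ be the algebra homomorphism (an isomorphism) with $t_H^K\mapsto (G/K\leftarrow G/H= G/H)$, $r_H^K\mapsto(G/H= G/H\to G/K)$, with the canonical projections $G/H\to G/K$, and $c_{g,H}\mapsto (G/{}^gH= G/{}^gH\to G/H)$, with the map $x\,{}^gH\mapsto xgH$. The Burnside trace $\mathrm{Btr}:\mu_R(G)\to RB(G)$ is the composite of $\beta$ and the $R$-linear map $RB(\Omega^2)\to RB(G)$ given by $(\Omega\xleftarrow{b}Z\xrightarrow{a}\Omega)\mapsto\{z\in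 Z: a(z)=b(z)\}$. Theorem. Let $\phi=(\phi_H)_{H\le G}$ be a family of $R$-linear forms $\phi_H:RB(H)\to R$ that is stable by induction, i.e. $\phi_G(\mathrm{Ind}_H^GX)=\phi_H(X)$ for every subgroup $H$ of $G$ and every finite $H$-set $X$. Then the bilinear form $(x,y)\mapsto\phi_G(\mathrm{Btr}(xy))$ on $\mu_R(G)$ is non-degenerate if and only if, for every subgroup $H$ of $G$, the bilinear form $b_{\phi_H}(X,Y)=\phi_H(XY)$ on $RB(H)$ is non-degenerate. -/

import Mathlib

open scoped TensorProduct

universe u v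

namespace MackeySymm

/-! ### The Burnside algebra -/

/-- A finite `G`-set. -/
structure FinGSet (G : Type u) [Group G] : Type (u + 1) where
  carrier : Type u
  [fin : Finite carrier]
  [act : MulAction G carrier]

attribute [instance] FinGSet.fin FinGSet.act

namespace FinGSet

variable {G : Type u} [Group G]

/-- Two finite `G`-sets are isomorphic. -/
def Iso (X Y : FinGSet G) : Prop :=
  ∃ e : X.carrier ≃ Y.carrier, ∀ (g : G) (x : X.carrier), e (g • x) = g • e x

theorem Iso.refl (X : FinGSet G) : Iso X X := ⟨Equiv.refl _, fun _ _ => rfl⟩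

theorem Iso.symm {X Y : FinGSet G} : Iso X Y → Iso Y X := by
  rintro ⟨e, he⟩
  exact ⟨e.symm, fun g y => by rw [Equiv.symm_apply_eq, he, e.apply_symm_apply]⟩

theorem Iso.trans {X Y Z : FinGSet G} : Iso X Y → Iso Y Z → Iso X Z := by
  rintro ⟨e, he⟩ ⟨f, hf⟩
  exact ⟨e.trans f, fun g x => by simp [he, hf]⟩

instance setoid (G : Type u) [Group G] : Setoid (FinGSet G) :=
  ⟨Iso, Iso.refl, Iso.symm, Iso.trans⟩

/-- The empty `G`-set. -/
def empty (G : Type u) [Group G] : FinGSet G where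
  carrier := PEmpty
  act := { smul := fun _ x => x, one_smul := fun _ => rfl, mul_smul := fun _ _ _ => rfl }

/-- The `G`-set with one point. -/
def point (G : Type u) [Group G] : FinGSet G where
  carrier := PUnit
  act := { smul := fun _ x => x, one_smul := fun _ => rfl, mul_smul := fun _ _ _ => rfl }

/-- Disjoint union. -/
def sum (X Y : FinGSet G) : FinGSet G := ⟨X.carrier ⊕ Y.carrier⟩

/-- Cartesian product, with the diagonal action. -/
def prod (X Y : FinGSet G) : FinGSet G := ⟨X.carrier × Y.carrier⟩

/-- Restriction of the action to a subgroup. -/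
def res (H : Subgroup G) (X : FinGSet G) : FinGSet H := ⟨X.carrier⟩

/-- The equivalence relation on `G × X` identifying `(g h⁻¹, h x)` with `(g, x)` for `h ∈ H`. -/
def indSetoid (H : Subgroup G) (X : FinGSet H) : Setoid (G × X.carrier) where
  r p q := ∃ h : H, q.1 = p.1 * (h : G)⁻¹ ∧ q.2 = h • p.2
  iseqv :=
    { refl := fun p => ⟨1, by simp, by simp⟩
      symm := by
        rintro p q ⟨h, h1, h2⟩
        exact ⟨h⁻¹, by simp [h1], by simp [h2]⟩
      trans := by
        rintro p q r ⟨h, h1, h2⟩ ⟨k, k1, k2⟩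
        exact ⟨k * h, by simp [h1, k1, mul_assoc], by simp [h2, k2, mul_smul]⟩ }

/-- Induction: `Ind_H^G X = G ×_H X`, where `G` acts by left multiplication on the first factor. -/
def ind [Finite G] (H : Subgroup G) (X : FinGSet H) : FinGSet G where
  carrier := Quotient (indSetoid H X)
  act :=
    { smul := fun g => Quotient.map (fun p => (g * p.1, p.2)) (by
        rintro p q ⟨h, h1, h2⟩
        exact ⟨h, by simp [h1, mul_assoc], h2⟩)
      one_smul := by
        rintro ⟨p⟩
        exact congrArg (Quotient.mk _) (by simp)
      mul_smul := by
        rintro g h ⟨p⟩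
        exact congrArg (Quotient.mk _) (by simp [mul_assoc]) }

end FinGSet

/-- The commutative semiring of isomorphism classes of finite `G`-sets, with disjoint union as
addition and cartesian product as multiplication. -/
def BurnsideSemiring (G : Type u) [Group G] : Type (u + 1) := Quotient (FinGSet.setoid G)

namespace BurnsideSemiring

variable {G : Type u} [Group G]

/-- The isomorphism class of a finite `G`-set. -/
def mk (X : FinGSet G) : BurnsideSemiring G := Quotient.mk _ X

theorem mk_eq {X Y : FinGSet G} : mk X = mk Y ↔ FinGSet.Iso X Y := Quotient.eq

instance : Zero (BurnsideSemiring G) := ⟨mk (FinGSet.empty G)⟩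

instance : One (BurnsideSemiring G) := ⟨mk (FinGSet.point G)⟩

instance : Add (BurnsideSemiring G) :=
  ⟨Quotient.map₂ FinGSet.sum (by
    rintro X X' ⟨e, he⟩ Y Y' ⟨f, hf⟩
    refine ⟨Equiv.sumCongr e f, ?_⟩
    rintro g (x | y)
    · exact congrArg Sum.inl (he g x)
    · exact congrArg Sum.inr (hf g y))⟩

instance : Mul (BurnsideSemiring G) :=
  ⟨Quotient.map₂ FinGSet.prod (by
    rintro X X' ⟨e, he⟩ Y Y' ⟨f, hf⟩
    exact ⟨Equiv.prodCongr e f, fun g p => Prod.ext (he g p.1) (hf g p.2)⟩)⟩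

theorem mk_add (X Y : FinGSet G) : mk X + mk Y = mk (X.sum Y) := rfl

theorem mk_mul (X Y : FinGSet G) : mk X * mk Y = mk (X.prod Y) := rfl

instance : CommSemiring (BurnsideSemiring G) where
  add_assoc := by
    rintro ⟨X⟩ ⟨Y⟩ ⟨Z⟩
    refine mk_eq.2 ⟨Equiv.sumAssoc _ _ _, ?_⟩
    rintro g ((x | x) | x) <;> rfl
  zero_add := by
    rintro ⟨X⟩
    refine mk_eq.2 ⟨Equiv.emptySum PEmpty _, ?_⟩
    rintro g (x | x)
    · exact x.elim
    · rfl
  add_zero := by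
    rintro ⟨X⟩
    refine mk_eq.2 ⟨Equiv.sumEmpty _ PEmpty, ?_⟩
    rintro g (x | x)
    · rfl
    · exact x.elim
  add_comm := by
    rintro ⟨X⟩ ⟨Y⟩
    refine mk_eq.2 ⟨Equiv.sumComm _ _, ?_⟩
    rintro g (x | x) <;> rfl
  mul_assoc := by
    rintro ⟨X⟩ ⟨Y⟩ ⟨Z⟩
    exact mk_eq.2 ⟨Equiv.prodAssoc _ _ _, fun _ _ => rfl⟩
  one_mul := by
    rintro ⟨X⟩
    exact mk_eq.2 ⟨Equiv.punitProd _, fun _ _ => rfl⟩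
  mul_one := by
    rintro ⟨X⟩
    exact mk_eq.2 ⟨Equiv.prodPUnit _, fun _ _ => rfl⟩
  mul_comm := by
    rintro ⟨X⟩ ⟨Y⟩
    exact mk_eq.2 ⟨Equiv.prodComm _ _, fun _ _ => rfl⟩
  left_distrib := by
    rintro ⟨X⟩ ⟨Y⟩ ⟨Z⟩
    refine mk_eq.2 ⟨Equiv.prodSumDistrib _ _ _, ?_⟩
    rintro g ⟨x, y | y⟩ <;> rfl
  right_distrib := by
    rintro ⟨X⟩ ⟨Y⟩ ⟨Z⟩
    refine mk_eq.2 ⟨Equiv.sumProdDistrib _ _ _, ?_⟩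
    rintro g ⟨y | y, x⟩ <;> rfl
  zero_mul := by
    rintro ⟨X⟩
    exact mk_eq.2 ⟨Equiv.pemptyProd _, fun _ x => x.1.elim⟩
  mul_zero := by
    rintro ⟨X⟩
    exact mk_eq.2 ⟨Equiv.prodPEmpty _, fun _ x => x.2.elim⟩
  nsmul := nsmulRec

/-- Restriction to a subgroup, on isomorphism classes. -/
def res (H : Subgroup G) : BurnsideSemiring G →+ BurnsideSemiring H where
  toFun := Quotient.map (FinGSet.res H) (by
    rintro X Y ⟨e, he⟩
    exact ⟨e, fun h x => he h x⟩)
  map_zero' := rfl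
  map_add' := by
    rintro ⟨X⟩ ⟨Y⟩
    refine mk_eq.2 ⟨Equiv.refl _, ?_⟩
    rintro h (x | x) <;> rfl

end BurnsideSemiring

/-- The Burnside algebra `RB(G)`. Since `R` is a ring, tensoring over `ℕ` with `R` adds the
additive inverses: this is `R ⊗_ℤ B(G)` for the Grothendieck ring `B(G)` of the semiring of
isomorphism classes of finite `G`-sets. -/
abbrev BurnsideAlgebra (R : Type v) [CommRing R] (G : Type u) [Group G] : Type (max v (u + 1)) :=
  R ⊗[ℕ] BurnsideSemiring G

/-- The element of `RB(G)` given by a finite `G`-set. -/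
def BurnsideAlgebra.cls (R : Type v) [CommRing R] {G : Type u} [Group G] (X : FinGSet G) :
    BurnsideAlgebra R G :=
  1 ⊗ₜ[ℕ] BurnsideSemiring.mk X

/-- The restriction map `RB(G) → RB(H)`. -/
noncomputable def BurnsideAlgebra.res (R : Type v) [CommRing R] {G : Type u} [Group G]
    (H : Subgroup G) : BurnsideAlgebra R G →ₗ[R] BurnsideAlgebra R H :=
  (BurnsideSemiring.res H).toNatLinearMap.baseChange R

/-! ### The algebra `RB(X²)` and the Burnside trace -/

/-- A finite `G`-set over `X × X`, written as a diagram `X ← Z → X` of `G`-sets. -/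
structure Span (G : Type u) [Group G] (X : Type u) [MulAction G X] : Type (u + 1) where
  carrier : Type u
  [fin : Finite carrier]
  [act : MulAction G carrier]
  left : carrier →[G] X
  right : carrier →[G] X

attribute [instance] Span.fin Span.act

namespace Span

variable {G : Type u} [Group G] {X : Type u} [MulAction G X]

/-- Isomorphism of finite `G`-sets over `X × X`. -/
def Iso (Y Z : Span G X) : Prop :=
  ∃ e : Y.carrier ≃ Z.carrier, (∀ (g : G) (y : Y.carrier), e (g • y) = g • e y) ∧
    (∀ y, Z.left (e y) = Y.left y) ∧ (∀ y, Z.right (e y) = Y.right y)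

theorem Iso.refl (Y : Span G X) : Iso Y Y :=
  ⟨Equiv.refl _, fun _ _ => rfl, fun _ => rfl, fun _ => rfl⟩

theorem Iso.symm {Y Z : Span G X} : Iso Y Z → Iso Z Y := by
  rintro ⟨e, he, hl, hr⟩
  exact ⟨e.symm, fun g y => by rw [Equiv.symm_apply_eq, he, e.apply_symm_apply],
    fun y => by rw [← hl, e.apply_symm_apply], fun y => by rw [← hr, e.apply_symm_apply]⟩

theorem Iso.trans {Y Z W : Span G X} : Iso Y Z → Iso Z W → Iso Y W := by
  rintro ⟨e, he, hl, hr⟩ ⟨f, hf, hl', hr'⟩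
  exact ⟨e.trans f, fun g x => by simp [he, hf], fun x => by simp [hl, hl'],
    fun x => by simp [hr, hr']⟩

instance setoid (G : Type u) [Group G] (X : Type u) [MulAction G X] : Setoid (Span G X) :=
  ⟨Iso, Iso.refl, Iso.symm, Iso.trans⟩

/-- The empty diagram. -/
def empty (G : Type u) [Group G] (X : Type u) [MulAction G X] : Span G X where
  carrier := PEmpty
  act := { smul := fun _ x => x, one_smul := fun _ => rfl, mul_smul := fun _ _ _ => rfl }
  left := @MulActionHom.mk _ _ _ _ (_) _ _ PEmpty.elim fun _ x => x.elim
  right := @MulActionHom.mk _ _ _ _ (_) _ _ PEmpty.elim fun _ x => x.elim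

/-- The identity diagram `X = X = X`. -/
def id (G : Type u) [Group G] (X : Type u) [MulAction G X] [Finite X] : Span G X where
  carrier := X
  left := MulActionHom.id G
  right := MulActionHom.id G

/-- Disjoint union. -/
def sum (Y Z : Span G X) : Span G X where
  carrier := Y.carrier ⊕ Z.carrier
  left := ⟨Sum.elim Y.left Z.left, by rintro g (y | z) <;> simp⟩
  right := ⟨Sum.elim Y.right Z.right, by rintro g (y | z) <;> simp⟩

/-- The diagonal action on the pullback. -/
instance pullbackAction (Y Z : Span G X) :
    MulAction G {p : Y.carrier × Z.carrier // Y.right p.1 = Z.left p.2} where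
  smul := fun g p => ⟨g • p.1, by simp [p.2]⟩
  one_smul := fun p => Subtype.ext (one_smul G p.1)
  mul_smul := fun g h p => Subtype.ext (mul_smul g h p.1)

/-- The pullback of the right leg of `Y` and the left leg of `Z`. -/
def comp (Y Z : Span G X) : Span G X where
  carrier := {p : Y.carrier × Z.carrier // Y.right p.1 = Z.left p.2}
  left := ⟨fun p => Y.left p.1.1, fun g p => map_smul Y.left g p.1.1⟩
  right := ⟨fun p => Z.right p.1.2, fun g p => map_smul Z.right g p.1.2⟩

/-- The `G`-set of the points `z` of `X ← Z → X` at which the two legs agree. -/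
def fixedLocus (Z : Span G X) : FinGSet G where
  carrier := {z : Z.carrier // Z.left z = Z.right z}
  act :=
    { smul := fun g z => ⟨g • z.1, by simp [z.2]⟩
      one_smul := fun z => Subtype.ext (one_smul G z.1)
      mul_smul := fun g h z => Subtype.ext (mul_smul g h z.1) }

end Span

/-- The semiring of isomorphism classes of finite `G`-sets over `X × X`, with disjoint union as
addition and pullback as multiplication. -/
def SpanSemiring (G : Type u) [Group G] (X : Type u) [MulAction G X] : Type (u + 1) :=
  Quotient (Span.setoid G X)

namespace SpanSemiring

variable {G : Type u} [Group G] {X : Type u} [MulAction G X]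

/-- The isomorphism class of a diagram. -/
def mk (Y : Span G X) : SpanSemiring G X := Quotient.mk _ Y

theorem mk_eq {Y Z : Span G X} : mk Y = mk Z ↔ Span.Iso Y Z := Quotient.eq

instance : Zero (SpanSemiring G X) := ⟨mk (Span.empty G X)⟩

instance [Finite X] : One (SpanSemiring G X) := ⟨mk (Span.id G X)⟩

instance : Add (SpanSemiring G X) :=
  ⟨Quotient.map₂ Span.sum (by
    rintro Y Y' ⟨e, he, hl, hr⟩ Z Z' ⟨f, hf, hl', hr'⟩
    refine ⟨Equiv.sumCongr e f, ?_, ?_, ?_⟩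
    · rintro g (x | y)
      · exact congrArg Sum.inl (he g x)
      · exact congrArg Sum.inr (hf g y)
    · rintro (x | y)
      · exact hl x
      · exact hl' y
    · rintro (x | y)
      · exact hr x
      · exact hr' y)⟩

instance : Mul (SpanSemiring G X) :=
  ⟨Quotient.map₂ Span.comp (by
    rintro Y Y' ⟨e, he, hl, hr⟩ Z Z' ⟨f, hf, hl', hr'⟩
    refine ⟨Equiv.subtypeEquiv (Equiv.prodCongr e f) (fun p => ?_), ?_, ?_, ?_⟩
    · simp [hr, hl']
    · exact fun g p => Subtype.ext (Prod.ext (he g p.1.1) (hf g p.1.2))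
    · exact fun p => hl p.1.1
    · exact fun p => hr' p.1.2)⟩

theorem mk_add (Y Z : Span G X) : mk Y + mk Z = mk (Y.sum Z) := rfl

theorem mk_mul (Y Z : Span G X) : mk Y * mk Z = mk (Y.comp Z) := rfl

theorem zero_def : (0 : SpanSemiring G X) = mk (Span.empty G X) := rfl

theorem one_def [Finite X] : (1 : SpanSemiring G X) = mk (Span.id G X) := rfl

instance : AddCommMonoid (SpanSemiring G X) where
  add_assoc := by
    rintro ⟨Y⟩ ⟨Z⟩ ⟨W⟩
    refine mk_eq.2 ⟨Equiv.sumAssoc _ _ _, ?_, ?_, ?_⟩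
    · rintro g ((x | x) | x) <;> rfl
    · rintro ((x | x) | x) <;> rfl
    · rintro ((x | x) | x) <;> rfl
  zero_add := by
    rintro ⟨Y⟩
    refine mk_eq.2 ⟨Equiv.emptySum PEmpty _, ?_, ?_, ?_⟩
    · rintro g (x | x)
      · exact x.elim
      · rfl
    · rintro (x | x)
      · exact x.elim
      · rfl
    · rintro (x | x)
      · exact x.elim
      · rfl
  add_zero := by
    rintro ⟨Y⟩
    refine mk_eq.2 ⟨Equiv.sumEmpty _ PEmpty, ?_, ?_, ?_⟩
    · rintro g (x | x)
      · rfl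
      · exact x.elim
    · rintro (x | x)
      · rfl
      · exact x.elim
    · rintro (x | x)
      · rfl
      · exact x.elim
  add_comm := by
    rintro ⟨Y⟩ ⟨Z⟩
    refine mk_eq.2 ⟨Equiv.sumComm _ _, ?_, ?_, ?_⟩
    · rintro g (x | x) <;> rfl
    · rintro (x | x) <;> rfl
    · rintro (x | x) <;> rfl
  nsmul := nsmulRec

instance [Finite X] : Semiring (SpanSemiring G X) where
  __ := (inferInstance : AddCommMonoid (SpanSemiring G X))
  mul_assoc := by
    rintro ⟨Y⟩ ⟨Z⟩ ⟨W⟩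
    refine mk_eq.2 ⟨
      { toFun := fun p => ⟨(p.1.1.1.1, ⟨(p.1.1.1.2, p.1.2), p.2⟩), p.1.1.2⟩
        invFun := fun p => ⟨(⟨(p.1.1, p.1.2.1.1), p.2⟩, p.1.2.1.2), p.1.2.2⟩
        left_inv := fun _ => rfl
        right_inv := fun _ => rfl }, fun _ _ => rfl, fun _ => rfl, fun _ => rfl⟩
  one_mul := by
    rintro ⟨Y⟩
    refine mk_eq.2 ⟨
      { toFun := fun p => p.1.2
        invFun := fun y => ⟨(Y.left y, y), rfl⟩
        left_inv := fun p => Subtype.ext (Prod.ext p.2.symm rfl)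
        right_inv := fun _ => rfl }, fun _ _ => rfl, fun p => p.2.symm, fun _ => rfl⟩
  mul_one := by
    rintro ⟨Y⟩
    refine mk_eq.2 ⟨
      { toFun := fun p => p.1.1
        invFun := fun y => ⟨(y, Y.right y), rfl⟩
        left_inv := fun p => Subtype.ext (Prod.ext rfl p.2)
        right_inv := fun _ => rfl }, fun _ _ => rfl, fun _ => rfl, fun p => p.2⟩
  left_distrib := by
    rintro ⟨Y⟩ ⟨Z⟩ ⟨W⟩
    refine mk_eq.2 ⟨
      { toFun := fun p => match p with
          | ⟨(y, Sum.inl z), h⟩ => Sum.inl ⟨(y, z), h⟩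
          | ⟨(y, Sum.inr z), h⟩ => Sum.inr ⟨(y, z), h⟩
        invFun := fun p => match p with
          | Sum.inl p => ⟨(p.1.1, Sum.inl p.1.2), p.2⟩
          | Sum.inr p => ⟨(p.1.1, Sum.inr p.1.2), p.2⟩
        left_inv := by rintro ⟨⟨y, z | z⟩, h⟩ <;> rfl
        right_inv := by rintro (p | p) <;> rfl }, ?_, ?_, ?_⟩
    · rintro g ⟨⟨y, z | z⟩, h⟩ <;> rfl
    · rintro ⟨⟨y, z | z⟩, h⟩ <;> rfl
    · rintro ⟨⟨y, z | z⟩, h⟩ <;> rfl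
  right_distrib := by
    rintro ⟨Y⟩ ⟨Z⟩ ⟨W⟩
    refine mk_eq.2 ⟨
      { toFun := fun p => match p with
          | ⟨(Sum.inl y, z), h⟩ => Sum.inl ⟨(y, z), h⟩
          | ⟨(Sum.inr y, z), h⟩ => Sum.inr ⟨(y, z), h⟩
        invFun := fun p => match p with
          | Sum.inl p => ⟨(Sum.inl p.1.1, p.1.2), p.2⟩
          | Sum.inr p => ⟨(Sum.inr p.1.1, p.1.2), p.2⟩
        left_inv := by rintro ⟨⟨y | y, z⟩, h⟩ <;> rfl
        right_inv := by rintro (p | p) <;> rfl }, ?_, ?_, ?_⟩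
    · rintro g ⟨⟨y | y, z⟩, h⟩ <;> rfl
    · rintro ⟨⟨y | y, z⟩, h⟩ <;> rfl
    · rintro ⟨⟨y | y, z⟩, h⟩ <;> rfl
  zero_mul := by
    rintro ⟨Y⟩
    have : IsEmpty ((Span.empty G X).comp Y).carrier := ⟨fun p => PEmpty.elim p.1.1⟩
    have : IsEmpty (Span.empty G X).carrier := ⟨fun p => PEmpty.elim p⟩
    exact mk_eq.2 ⟨Equiv.equivOfIsEmpty _ _, fun _ p => isEmptyElim p, fun p => isEmptyElim p,
      fun p => isEmptyElim p⟩
  mul_zero := by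
    rintro ⟨Y⟩
    have : IsEmpty (Y.comp (Span.empty G X)).carrier := ⟨fun p => PEmpty.elim p.1.2⟩
    have : IsEmpty (Span.empty G X).carrier := ⟨fun p => PEmpty.elim p⟩
    exact mk_eq.2 ⟨Equiv.equivOfIsEmpty _ _, fun _ p => isEmptyElim p, fun p => isEmptyElim p,
      fun p => isEmptyElim p⟩

/-- `(X ← Z → X) ↦ {z ∈ Z | the two legs agree at z}`, on isomorphism classes. -/
def btr : SpanSemiring G X →+ BurnsideSemiring G where
  toFun := Quotient.map Span.fixedLocus (by
    rintro Y Z ⟨e, he, hl, hr⟩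
    exact ⟨Equiv.subtypeEquiv e (fun y => by rw [hl, hr]), fun g y => Subtype.ext (he g y.1)⟩)
  map_zero' := by
    have : IsEmpty (Span.empty G X).fixedLocus.carrier := ⟨fun p => PEmpty.elim p.1⟩
    have : IsEmpty (FinGSet.empty G).carrier := ⟨fun p => PEmpty.elim p⟩
    exact BurnsideSemiring.mk_eq.2 ⟨Equiv.equivOfIsEmpty _ _, fun _ p => isEmptyElim p⟩
  map_add' := by
    rintro ⟨Y⟩ ⟨Z⟩
    refine BurnsideSemiring.mk_eq.2 ⟨
      { toFun := fun p => match p with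
          | ⟨Sum.inl y, h⟩ => Sum.inl ⟨y, h⟩
          | ⟨Sum.inr y, h⟩ => Sum.inr ⟨y, h⟩
        invFun := fun p => match p with
          | Sum.inl p => ⟨Sum.inl p.1, p.2⟩
          | Sum.inr p => ⟨Sum.inr p.1, p.2⟩
        left_inv := by rintro ⟨y | y, h⟩ <;> rfl
        right_inv := by rintro (p | p) <;> rfl }, ?_⟩
    rintro g ⟨y | y, h⟩ <;> rfl

end SpanSemiring

/-- The `R`-algebra `RB(X²)`, for a finite `G`-set `X`: the Grothendieck group of the finite
`G`-sets over `X × X`, with scalars extended to `R`. -/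
abbrev SpanAlgebra (R : Type v) [CommRing R] (G : Type u) [Group G] (X : Type u) [MulAction G X]
    [Finite X] : Type (max v (u + 1)) :=
  R ⊗[ℕ] SpanSemiring G X

/-- The Burnside trace `RB(X²) → RB(G)`. -/
noncomputable def SpanAlgebra.btr (R : Type v) [CommRing R] (G : Type u) [Group G] (X : Type u)
    [MulAction G X] [Finite X] : SpanAlgebra R G X →ₗ[R] BurnsideAlgebra R G :=
  (SpanSemiring.btr (G := G) (X := X)).toNatLinearMap.baseChange R

/-! ### The Mackey algebra -/

section Mackey

variable {G : Type u} [Group G]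

/-- The left conjugate `ᵍH = g H g⁻¹`. Note that `H ^ g = g⁻¹ H g` is `lconj g⁻¹ H`. -/
def lconj (g : G) (H : Subgroup G) : Subgroup G := H.map (MulAut.conj g).toMonoidHom

theorem mem_lconj {g x : G} {H : Subgroup G} : x ∈ lconj g H ↔ g⁻¹ * x * g ∈ H := by
  constructor
  · rintro ⟨y, hy, rfl⟩
    simpa [mul_assoc] using hy
  · intro h
    exact ⟨_, h, by simp [mul_assoc]⟩

theorem lconj_one (H : Subgroup G) : lconj 1 H = H := by ext; simp [mem_lconj]

theorem lconj_lconj (g h : G) (H : Subgroup G) : lconj g (lconj h H) = lconj (g * h) H := by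
  ext; simp [mem_lconj, mul_assoc]

theorem lconj_mono (g : G) {H K : Subgroup G} (h : H ≤ K) : lconj g H ≤ lconj g K :=
  Subgroup.map_mono h

theorem inv_lconj (g : G) (H : Subgroup G) : lconj g⁻¹ (lconj g H) = H := by
  rw [lconj_lconj, inv_mul_cancel, lconj_one]

theorem lconj_inv (g : G) (H : Subgroup G) : lconj g (lconj g⁻¹ H) = H := by
  rw [lconj_lconj, mul_inv_cancel, lconj_one]

theorem lconj_inf (g : G) (H K : Subgroup G) : lconj g (H ⊓ K) = lconj g H ⊓ lconj g K := by
  ext; simp [mem_lconj]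

theorem lconj_self {H : Subgroup G} {h : G} (hh : h ∈ H) : lconj h H = H := by
  ext x
  rw [mem_lconj, Subgroup.mul_mem_cancel_right _ hh, Subgroup.mul_mem_cancel_left _ (inv_mem hh)]

/-- `T` is a complete system of representatives, without repetition, of the double cosets
`L \ H / K`, for subgroups `L` and `K` of `H`. -/
def IsDoubleCosetReps (L H K : Subgroup G) (T : Finset G) : Prop :=
  (∀ t ∈ T, t ∈ H) ∧ ∀ x ∈ H, ∃! t, t ∈ T ∧ ∃ l ∈ L, ∃ k ∈ K, x = l * t * k

/-- The generators `t_H^K` and `r^K_H`, for `H ≤ K`, and `c_{g,H}` of the Mackey algebra. -/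
inductive MackeyGen (G : Type u) [Group G] : Type u
  | t (H K : Subgroup G) (h : H ≤ K)
  | r (H K : Subgroup G) (h : H ≤ K)
  | c (g : G) (H : Subgroup G)

/-- `t_H^K`, `r^K_H` and `c_{g,H}` go from `H` to `K`, from `K` to `H` and from `H` to `ᵍH`. -/
def MackeyGen.source : MackeyGen G → Subgroup G
  | t H _ _ => H
  | r _ K _ => K
  | c _ H => H

/-- The target of a generator, see the definition of the source. -/
def MackeyGen.target : MackeyGen G → Subgroup G
  | t _ K _ => K
  | r H _ _ => H
  | c g H => lconj g H

variable (R : Type v) [CommRing R]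

/-- `t_H^K` in the free algebra. -/
def genT (H K : Subgroup G) (h : H ≤ K) : FreeAlgebra R (MackeyGen G) :=
  FreeAlgebra.ι R (MackeyGen.t H K h)

/-- `r^K_H` in the free algebra. -/
def genR (H K : Subgroup G) (h : H ≤ K) : FreeAlgebra R (MackeyGen G) :=
  FreeAlgebra.ι R (MackeyGen.r H K h)

/-- `c_{g,H}` in the free algebra. -/
def genC (g : G) (H : Subgroup G) : FreeAlgebra R (MackeyGen G) :=
  FreeAlgebra.ι R (MackeyGen.c g H)

/-- The defining relations of the Mackey algebra. -/
inductive MackeyRel : FreeAlgebra R (MackeyGen G) → FreeAlgebra R (MackeyGen G) → Prop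
  | sum_one : MackeyRel (∑ᶠ H : Subgroup G, genT R H H le_rfl) 1
  | t_eq_r (H : Subgroup G) : MackeyRel (genT R H H le_rfl) (genR R H H le_rfl)
  | r_eq_c (H : Subgroup G) (h : G) (hh : h ∈ H) : MackeyRel (genR R H H le_rfl) (genC R h H)
  | t_mul_t (H K L : Subgroup G) (hHK : H ≤ K) (hKL : K ≤ L) :
      MackeyRel (genT R K L hKL * genT R H K hHK) (genT R H L (hHK.trans hKL))
  | r_mul_r (H K L : Subgroup G) (hHK : H ≤ K) (hKL : K ≤ L) :
      MackeyRel (genR R H K hHK * genR R K L hKL) (genR R H L (hHK.trans hKL))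
  | c_mul_c (g g' : G) (H : Subgroup G) :
      MackeyRel (genC R g' (lconj g H) * genC R g H) (genC R (g' * g) H)
  | t_mul_c (g : G) (H K : Subgroup G) (h : H ≤ K) :
      MackeyRel (genT R (lconj g H) (lconj g K) (lconj_mono g h) * genC R g H)
        (genC R g K * genT R H K h)
  | r_mul_c (g : G) (H K : Subgroup G) (h : H ≤ K) :
      MackeyRel (genR R (lconj g H) (lconj g K) (lconj_mono g h) * genC R g K)
        (genC R g H * genR R H K h)
  | mackey (L H K : Subgroup G) (hL : L ≤ H) (hK : K ≤ H) (T : Finset G)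
      (hT : IsDoubleCosetReps L H K T) :
      MackeyRel (genR R L H hL * genT R K H hK)
        (∑ h ∈ T, genT R (L ⊓ lconj h K) L inf_le_left * genC R h (lconj h⁻¹ L ⊓ K) *
          genR R (lconj h⁻¹ L ⊓ K) K inf_le_right)
  | other (a b : MackeyGen G) (h : a.source ≠ b.target) :
      MackeyRel (FreeAlgebra.ι R a * FreeAlgebra.ι R b) 0

variable (G) in
/-- The Mackey algebra `μ_R(G)`, by generators and relations. -/
abbrev MackeyAlgebra : Type (max u v) := RingQuot (MackeyRel (G := G) R)

end Mackey

/-! ### The isomorphism from the Mackey algebra to `RB(Ω²)` -/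

/-- The `G`-set `Ω_G`, the disjoint union of the `G/L` for all subgroups `L` of `G`. -/
def Omega (G : Type u) [Group G] : Type u := Σ L : Subgroup G, G ⧸ L

namespace Omega

variable {G : Type u} [Group G]

instance [Finite G] : Finite (Omega G) :=
  inferInstanceAs (Finite (Σ L : Subgroup G, G ⧸ L))

instance : MulAction G (Omega G) where
  smul g x := ⟨x.1, g • x.2⟩
  one_smul x := by
    change (⟨x.1, (1 : G) • x.2⟩ : Σ L : Subgroup G, G ⧸ L) = x
    rw [one_smul]
    rfl
  mul_smul g h x := by
    change (⟨x.1, (g * h) • x.2⟩ : Σ L : Subgroup G, G ⧸ L) = ⟨x.1, g • h • x.2⟩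
    rw [mul_smul]

/-- The element `xL` of the component `G/L` of `Ω_G`. -/
def coset (L : Subgroup G) (x : G) : Omega G := ⟨L, (x : G ⧸ L)⟩

theorem smul_coset (L : Subgroup G) (g x : G) : g • coset L x = coset L (g * x) := rfl

theorem coset_eq {L : Subgroup G} {x y : G} : coset L x = coset L y ↔ x⁻¹ * y ∈ L := by
  rw [← QuotientGroup.eq]
  constructor
  · intro h
    exact eq_of_heq (Sigma.mk.inj h).2
  · intro h
    exact congrArg (Sigma.mk L) h

theorem eq_of_coset_eq {L M : Subgroup G} {x y : G} (h : coset L x = coset M y) : L = M :=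
  (Sigma.mk.inj h).1

/-- The map of `G`-sets `G/A → G/K ⊆ Ω_G` given by `xA ↦ xgK`, where `A ≤ ᵍK`. -/
def leg (A : Subgroup G) (g : G) (K : Subgroup G) (h : A ≤ lconj g K) : (G ⧸ A) →[G] Omega G where
  toFun := fun q => Quotient.liftOn' q (fun x => coset K (x * g)) (by
    intro x y hxy
    rw [QuotientGroup.leftRel_apply] at hxy
    rw [coset_eq]
    have := mem_lconj.1 (h hxy)
    simpa [mul_assoc] using this)
  map_smul' := by
    intro m q
    induction q using QuotientGroup.induction_on with
    | H x => exact congrArg (coset K) (mul_assoc m x g)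

theorem leg_mk (A : Subgroup G) (g : G) (K : Subgroup G) (h : A ≤ lconj g K) (x : G) :
    leg A g K h (x : G ⧸ A) = coset K (x * g) := rfl

end Omega

/-- Disjoint union of a finite family of diagrams. -/
def Span.sigma {G : Type u} [Group G] {X : Type u} [MulAction G X] {ι : Type u} [Finite ι] (F : ι → Span G X) :
    Span G X where
  carrier := Σ i, (F i).carrier
  left := ⟨fun p => (F p.1).left p.2, fun g p => map_smul (F p.1).left g p.2⟩
  right := ⟨fun p => (F p.1).right p.2, fun g p => map_smul (F p.1).right g p.2⟩

theorem SpanSemiring.sum_mk {G : Type u} [Group G] {X : Type u} [MulAction G X] {ι : Type u} (T : Finset ι)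
    (F : ι → Span G X) :
    ∑ i ∈ T, SpanSemiring.mk (F i) = SpanSemiring.mk (Span.sigma fun i : T => F i) := by
  classical
  induction T using Finset.induction_on with
  | empty =>
    rw [Finset.sum_empty, zero_def]
    have : IsEmpty (Span.sigma fun i : (∅ : Finset ι) => F i).carrier :=
      ⟨fun p => absurd p.1.2 (Finset.notMem_empty _)⟩
    have : IsEmpty (Span.empty G X).carrier := ⟨fun p => PEmpty.elim p⟩
    exact mk_eq.2 ⟨Equiv.equivOfIsEmpty _ _, fun _ p => isEmptyElim p, fun p => isEmptyElim p,
      fun p => isEmptyElim p⟩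
  | insert a T ha ih =>
    rw [Finset.sum_insert ha, ih, mk_add, mk_eq]
    let f : (F a).carrier ⊕ (Σ i : T, (F i).carrier) →
        (Σ i : (insert a T : Finset ι), (F i).carrier) :=
      Sum.elim (fun z => ⟨⟨a, Finset.mem_insert_self a T⟩, z⟩)
        (fun p => ⟨⟨p.1.1, Finset.mem_insert_of_mem p.1.2⟩, p.2⟩)
    have hf : Function.Bijective f := by
      constructor
      · rintro (z | ⟨⟨i, hi⟩, z⟩) (w | ⟨⟨j, hj⟩, w⟩) h
        · simp only [f, Sum.elim_inl, Sigma.mk.injEq, heq_eq_eq, true_and] at h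
          rw [h]
        · simp only [f, Sum.elim_inl, Sum.elim_inr, Sigma.mk.injEq, Subtype.mk.injEq] at h
          exact absurd (h.1 ▸ hj) ha
        · simp only [f, Sum.elim_inl, Sum.elim_inr, Sigma.mk.injEq, Subtype.mk.injEq] at h
          exact absurd (h.1 ▸ hi) ha
        · simp only [f, Sum.elim_inr, Sigma.mk.injEq, Subtype.mk.injEq] at h
          obtain ⟨rfl, h⟩ := h
          rw [eq_of_heq h]
      · rintro ⟨⟨i, hi⟩, z⟩
        by_cases h : i = a
        · subst h
          exact ⟨Sum.inl z, rfl⟩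
        · exact ⟨Sum.inr ⟨⟨i, Finset.mem_of_mem_insert_of_ne hi h⟩, z⟩, rfl⟩
    refine ⟨Equiv.ofBijective f hf, ?_, ?_, ?_⟩
    · rintro g (z | z) <;> rfl
    · rintro (z | z) <;> rfl
    · rintro (z | z) <;> rfl

theorem le_lconj_mul {G : Type u} [Group G] {A B M : Subgroup G} {g k g' : G} (hM : B ≤ lconj g' M) :
    A ⊓ lconj (g * k) B ≤ lconj (g * k * g') M := by
  rw [← lconj_lconj (g * k) g' M]
  exact inf_le_right.trans (lconj_mono _ hM)

section Beta

variable {G : Type u} [Group G] [Finite G]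

/-- The diagram `G/H ← G/A → G/K` over `Ω_G` with legs `xA ↦ xH` and `xA ↦ xgK`. -/
def orbitSpan (H A : Subgroup G) (g : G) (K : Subgroup G) (hH : A ≤ H) (hK : A ≤ lconj g K) :
    Span G (Omega G) where
  carrier := G ⧸ A
  left := Omega.leg A 1 H (by rwa [lconj_one])
  right := Omega.leg A g K hK

/-- The images of the generators: `t_H^K ↦ (G/K ← G/H = G/H)`, `r^K_H ↦ (G/H = G/H → G/K)` and
`c_{g,H} ↦ (G/ᵍH = G/ᵍH → G/H)`, where the last map sends `x ᵍH` to `x g H`. -/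
def betaGen : MackeyGen G → SpanSemiring G (Omega G)
  | .t H K h => .mk (orbitSpan K H 1 H h (by rw [lconj_one]))
  | .r H K h => .mk (orbitSpan H H 1 K le_rfl (by rwa [lconj_one]))
  | .c g H => .mk (orbitSpan (lconj g H) (lconj g H) g H le_rfl le_rfl)

/-- The class of `orbitSpan`. -/
def orb (H A : Subgroup G) (g : G) (K : Subgroup G) (hH : A ≤ H) (hK : A ≤ lconj g K) :
    SpanSemiring G (Omega G) := .mk (orbitSpan H A g K hH hK)

theorem orb_mul_of_ne {H A K K' B M : Subgroup G} {g g' : G} (hH : A ≤ H) (hK : A ≤ lconj g K)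
    (hK' : B ≤ K') (hM : B ≤ lconj g' M) (hne : K ≠ K') :
    orb H A g K hH hK * orb K' B g' M hK' hM = 0 := by
  rw [orb, orb, SpanSemiring.mk_mul, SpanSemiring.zero_def, SpanSemiring.mk_eq]
  have : IsEmpty ((orbitSpan H A g K hH hK).comp (orbitSpan K' B g' M hK' hM)).carrier := by
    constructor
    rintro ⟨⟨x, y⟩, h⟩
    induction x using QuotientGroup.induction_on with
    | H x =>
      induction y using QuotientGroup.induction_on with
      | H y => exact hne (Omega.eq_of_coset_eq h)
  have : IsEmpty (Span.empty G (Omega G)).carrier := ⟨fun p => PEmpty.elim p⟩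
  exact ⟨Equiv.equivOfIsEmpty _ _, fun _ p => isEmptyElim p, fun p => isEmptyElim p,
    fun p => isEmptyElim p⟩

/-- The Mackey formula for the product of two transitive diagrams. -/
theorem orb_mul {H A K B M : Subgroup G} {g g' : G} (hH : A ≤ H) (hK : A ≤ lconj g K)
    (hK' : B ≤ K) (hM : B ≤ lconj g' M) (T : Finset G)
    (hT : IsDoubleCosetReps (lconj g⁻¹ A) K B T) :
    orb H A g K hH hK * orb K B g' M hK' hM =
      ∑ k ∈ T, orb H (A ⊓ lconj (g * k) B) (g * k * g') M (inf_le_left.trans hH)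
        (le_lconj_mul hM) := by
  simp only [orb]
  rw [SpanSemiring.mk_mul, SpanSemiring.sum_mk]
  symm
  rw [SpanSemiring.mk_eq]
  have key : ∀ (k : T) (x : G),
      (orbitSpan H A g K hH hK).right (x : G ⧸ A) =
        (orbitSpan K B g' M hK' hM).left ((x * (g * k) : G) : G ⧸ B) := by
    intro k x
    refine Omega.coset_eq.2 ?_
    have := hT.1 k k.2
    simpa [mul_assoc] using this
  let f : (Σ k : T, G ⧸ (A ⊓ lconj (g * k) B)) →
      ((orbitSpan H A g K hH hK).comp (orbitSpan K B g' M hK' hM)).carrier := fun p =>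
    Quotient.liftOn' p.2 (fun x => ⟨((x : G ⧸ A), ((x * (g * p.1) : G) : G ⧸ B)), key p.1 x⟩) (by
      intro x y hxy
      rw [QuotientGroup.leftRel_apply] at hxy
      refine Subtype.ext (Prod.ext (QuotientGroup.eq.2 hxy.1) (QuotientGroup.eq.2 ?_))
      have := mem_lconj.1 hxy.2
      simpa [mul_assoc] using this)
  have hf : Function.Bijective f := by
    constructor
    · rintro ⟨k, p⟩ ⟨k', p'⟩ h
      induction p using QuotientGroup.induction_on with
      | H x =>
      induction p' using QuotientGroup.induction_on with
      | H x' =>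
        have h1 : x⁻¹ * x' ∈ A := QuotientGroup.eq.1 (congrArg (fun z => z.1.1) h)
        have h2 : (x * (g * k))⁻¹ * (x' * (g * k')) ∈ B :=
          QuotientGroup.eq.1 (congrArg (fun z => z.1.2) h)
        have hkk : k = k' := by
          obtain ⟨t, -, ht⟩ := hT.2 k (hT.1 k k.2)
          refine Subtype.ext ((ht k ⟨k.2, 1, one_mem _, 1, one_mem _, by simp⟩).trans
            (ht k' ⟨k'.2, g⁻¹ * (x⁻¹ * x') * g, ?_, _, inv_mem h2, ?_⟩).symm)
          · rw [mem_lconj]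
            simpa [mul_assoc] using h1
          · group
        subst hkk
        refine congrArg (Sigma.mk k) (QuotientGroup.eq.2 ⟨h1, mem_lconj.2 ?_⟩)
        simpa [mul_assoc] using h2
    · rintro ⟨⟨p, q⟩, h⟩
      induction p using QuotientGroup.induction_on with
      | H x =>
      induction q using QuotientGroup.induction_on with
      | H y =>
        have h0 : (x * g)⁻¹ * (y * 1) ∈ K := Omega.coset_eq.1 h
        obtain ⟨k, ⟨hk, l, hl, b, hb, e⟩, -⟩ := hT.2 _ h0
        have hl' : g * l * g⁻¹ ∈ A := by
          have := mem_lconj.1 hl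
          simpa using this
        have hy : y = x * g * (l * k * b) := by
          rw [← e]; group
        refine ⟨⟨⟨k, hk⟩, ((x * (g * l * g⁻¹) : G) : G ⧸ _)⟩, Subtype.ext (Prod.ext ?_ ?_)⟩
        · refine QuotientGroup.eq.2 ?_
          simpa [mul_assoc] using inv_mem hl'
        · refine QuotientGroup.eq.2 ?_
          rw [hy]
          convert hb using 1
          group
  refine ⟨Equiv.ofBijective f hf, ?_, ?_, ?_⟩
  · rintro m ⟨k, p⟩
    induction p using QuotientGroup.induction_on with
    | H x => exact Subtype.ext (Prod.ext rfl (congrArg (fun z : G => (z : G ⧸ B)) (mul_assoc m x (g * k))))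
  · rintro ⟨k, p⟩
    induction p using QuotientGroup.induction_on with
    | H x => rfl
  · rintro ⟨k, p⟩
    induction p using QuotientGroup.induction_on with
    | H x => exact congrArg (Omega.coset M) (by group)

theorem orb_congr {H A A' K : Subgroup G} {g g' : G} (hH : A ≤ H) (hK : A ≤ lconj g K)
    (hA : A = A') (hg : g = g') :
    orb H A g K hH hK = orb H A' g' K (hA ▸ hH) (hg ▸ hA ▸ hK) := by
  subst hA hg; rfl

/-- The product when the double coset space has one point. -/
theorem orb_mul_single {H A K B M C : Subgroup G} {g g' : G} (hH : A ≤ H) (hK : A ≤ lconj g K)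
    (hK' : B ≤ K) (hM : B ≤ lconj g' M) (hAB : B = K ∨ lconj g⁻¹ A = K)
    (hC : A ⊓ lconj g B = C) (hCH : C ≤ H) (hCM : C ≤ lconj (g * g') M) :
    orb H A g K hH hK * orb K B g' M hK' hM = orb H C (g * g') M hCH hCM := by
  rw [orb_mul hH hK hK' hM {1}]
  · rw [Finset.sum_singleton]
    exact orb_congr _ _ (by rw [mul_one, hC]) (by rw [mul_one])
  · refine ⟨by simp [one_mem], fun x hx => ⟨1, ⟨by simp, ?_⟩, fun y hy => by simpa using hy.1⟩⟩
    rcases hAB with rfl | h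
    · exact ⟨1, one_mem _, x, hx, by simp⟩
    · exact ⟨x, h ▸ hx, 1, one_mem _, by simp⟩

theorem sum_orb_eq_one :
    ∑ᶠ H : Subgroup G, orb H H 1 H le_rfl (by rw [lconj_one]) =
      (1 : SpanSemiring G (Omega G)) := by
  classical
  have := Fintype.ofFinite (Subgroup G)
  rw [finsum_eq_sum_of_fintype]
  simp only [orb]
  rw [SpanSemiring.sum_mk, SpanSemiring.one_def, SpanSemiring.mk_eq]
  refine ⟨
    { toFun := fun p => (⟨p.1.1, p.2⟩ : Σ L : Subgroup G, G ⧸ L)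
      invFun := fun (x : Σ L : Subgroup G, G ⧸ L) => ⟨⟨x.1, Finset.mem_univ _⟩, x.2⟩
      left_inv := fun _ => rfl
      right_inv := fun _ => rfl }, fun _ _ => rfl, ?_, ?_⟩ <;>
  · rintro ⟨L, p⟩
    induction p using QuotientGroup.induction_on with
    | H x => exact congrArg (Omega.coset L.1) (mul_one x).symm

theorem betaGen_mul_of_ne (a b : MackeyGen G) (h : a.source ≠ b.target) :
    betaGen a * betaGen b = 0 := by
  cases a <;> cases b <;> exact orb_mul_of_ne _ _ _ _ h

/-- The diagram of `t c r`. -/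
theorem orb_mackey (h : G) {K : Subgroup G} (B : Subgroup G) (hB : B ≤ K) (A L : Subgroup G)
    (hA : A = lconj h B) (hL : A ≤ L) :
    orb L A 1 A hL (by rw [lconj_one]) * orb (lconj h B) (lconj h B) h B le_rfl le_rfl *
      orb B B 1 K le_rfl (by rwa [lconj_one]) =
    orb L A h K hL (hA ▸ lconj_mono h hB) := by
  subst hA
  rw [orb_mul_single (C := lconj h B) _ _ _ _ (Or.inl rfl) (by simp [lconj_one]) hL (by simp),
    orb_mul_single (C := lconj h B) _ _ _ _ (Or.inl rfl) (by simp) hL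
      (by simpa using lconj_mono h hB)]
  exact orb_congr _ _ rfl (by simp)

variable (R : Type v) [CommRing R]

/-- The extension of `betaGen` to the free algebra. -/
noncomputable def betaFree : FreeAlgebra R (MackeyGen G) →ₐ[R] SpanAlgebra R G (Omega G) :=
  FreeAlgebra.lift R fun a => 1 ⊗ₜ[ℕ] betaGen a

theorem betaFree_t (H K : Subgroup G) (h : H ≤ K) :
    betaFree R (genT R H K h) = 1 ⊗ₜ[ℕ] orb K H 1 H h (by rw [lconj_one]) := by
  simp [betaFree, genT, betaGen, orb]

theorem betaFree_r (H K : Subgroup G) (h : H ≤ K) :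
    betaFree R (genR R H K h) = 1 ⊗ₜ[ℕ] orb H H 1 K le_rfl (by rwa [lconj_one]) := by
  simp [betaFree, genR, betaGen, orb]

theorem betaFree_c (g : G) (H : Subgroup G) :
    betaFree R (genC R g H) = 1 ⊗ₜ[ℕ] orb (lconj g H) (lconj g H) g H le_rfl le_rfl := by
  simp [betaFree, genC, betaGen, orb]

/-- The diagram of an element `h ∈ H` is the identity of `G/H`. -/
theorem orb_self {H : Subgroup G} {h : G} (hh : h ∈ H) :
    orb (lconj h H) (lconj h H) h H le_rfl le_rfl = orb H H 1 H le_rfl (by rw [lconj_one]) := by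
  have e : ∀ (L : Subgroup G) (hL : L = H) (h1 : L ≤ lconj h H),
      orb L L h H le_rfl h1 = orb H H 1 H le_rfl (by rw [lconj_one]) := by
    rintro L rfl h1
    rw [orb, orb, SpanSemiring.mk_eq]
    refine ⟨Equiv.refl _, fun _ _ => rfl, fun _ => rfl, fun p => ?_⟩
    induction p using QuotientGroup.induction_on with
    | H x =>
      refine Omega.coset_eq.2 ?_
      simpa [mul_assoc] using hh
  exact e _ (lconj_self hh) _

theorem betaFree_rel {a b : FreeAlgebra R (MackeyGen G)} (h : MackeyRel R a b) :
    betaFree R a = betaFree R b := by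
  have tmul : ∀ x y : SpanSemiring G (Omega G),
      ((1 : R) ⊗ₜ[ℕ] x) * ((1 : R) ⊗ₜ[ℕ] y) = (1 : R) ⊗ₜ[ℕ] (x * y) := fun x y => by simp
  induction h with
  | sum_one =>
    have := Fintype.ofFinite (Subgroup G)
    rw [finsum_eq_sum_of_fintype, map_sum, map_one]
    simp only [betaFree_t]
    rw [← TensorProduct.tmul_sum, ← finsum_eq_sum_of_fintype, sum_orb_eq_one]
    rfl
  | t_eq_r H => rw [betaFree_t, betaFree_r]
  | r_eq_c H h hh => rw [betaFree_r, betaFree_c, orb_self hh]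
  | t_mul_t H K L hHK hKL =>
    simp only [map_mul, betaFree_t, tmul]
    rw [orb_mul_single (C := H) _ _ _ _ (Or.inr (by simp [lconj_one]))
      (by simpa [lconj_one] using hHK) (hHK.trans hKL) (by simp [lconj_one])]
    congr 1
    exact orb_congr _ _ rfl (one_mul 1)
  | r_mul_r H K L hHK hKL =>
    simp only [map_mul, betaFree_r, tmul]
    rw [orb_mul_single (C := H) _ _ _ _ (Or.inl rfl)
      (by simpa [lconj_one] using hHK) le_rfl (by simpa [lconj_one] using hHK.trans hKL)]
    congr 1
    exact orb_congr _ _ rfl (one_mul 1)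
  | c_mul_c g g' H =>
    simp only [map_mul, betaFree_c, tmul]
    rw [orb_mul_single (C := lconj g' (lconj g H)) _ _ _ _ (Or.inl rfl)
      (by simp) le_rfl (by simp [lconj_lconj])]
    simp only [lconj_lconj]
  | t_mul_c g H K h =>
    simp only [map_mul, betaFree_c, betaFree_t, tmul]
    rw [orb_mul_single (C := lconj g H) _ _ _ _ (Or.inl rfl)
      (by simp [lconj_one]) (lconj_mono g h) (by simp),
      orb_mul_single (C := lconj g H) _ _ _ _ (Or.inr (inv_lconj g K))
      (by simpa using lconj_mono g h) (lconj_mono g h) (by simp)]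
    congr 1
    exact orb_congr _ _ rfl (by simp)
  | r_mul_c g H K h =>
    simp only [map_mul, betaFree_c, betaFree_r, tmul]
    rw [orb_mul_single (C := lconj g H) _ _ _ _ (Or.inl rfl)
      (by simpa [lconj_one] using lconj_mono g h) le_rfl (by simpa using lconj_mono g h),
      orb_mul_single (C := lconj g H) _ _ _ _ (Or.inl rfl)
      (by simp) le_rfl (by simpa using lconj_mono g h)]
    congr 1
    exact orb_congr _ _ rfl (by simp)
  | mackey L H K hL hK T hT =>
    simp only [map_mul, map_sum, betaFree_c, betaFree_r, betaFree_t, tmul]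
    rw [← TensorProduct.tmul_sum]
    congr 1
    rw [orb_mul _ _ _ _ T (by simpa [lconj_one] using hT)]
    refine Finset.sum_congr rfl fun h _ => ?_
    rw [orb_mackey h (lconj h⁻¹ L ⊓ K) inf_le_right (L ⊓ lconj h K) L
      (by rw [lconj_inf, lconj_inv]) inf_le_left]
    exact orb_congr _ _ (by rw [one_mul]) (by simp)
  | other a b h =>
    simp only [map_mul, map_zero, betaFree, FreeAlgebra.lift_ι_apply, tmul,
      betaGen_mul_of_ne a b h, TensorProduct.tmul_zero]

variable (G) in
/-- The algebra homomorphism `β : μ_R(G) → RB(Ω²)`; it is an isomorphism. -/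
noncomputable def beta : MackeyAlgebra G R →ₐ[R] SpanAlgebra R G (Omega G) :=
  RingQuot.liftAlgHom R ⟨betaFree R, fun _ _ h => betaFree_rel R h⟩

variable (G) in
/-- The Burnside trace `Btr : μ_R(G) → RB(G)` of the Mackey algebra. -/
noncomputable def mackeyBtr : MackeyAlgebra G R →ₗ[R] BurnsideAlgebra R G :=
  SpanAlgebra.btr R G (Omega G) ∘ₗ (beta G R).toLinearMap

end Beta

/-! ### The bilinear forms -/

section Forms

variable {R : Type v} [CommRing R] {G : Type u} [Group G]

/-- The bilinear form `(x, y) ↦ f (x y)` on an `R`-algebra. -/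
noncomputable def traceForm {A : Type*} [Semiring A] [Algebra R A] (f : A →ₗ[R] R) :
    A →ₗ[R] A →ₗ[R] R :=
  (LinearMap.mul R A).compr₂ f

/-- A bilinear form is non-degenerate if `x ↦ b(x, -)` is an isomorphism from `A` onto its dual
`Hom_R(A, R)`. -/
def IsNondegenerate {A : Type*} [AddCommMonoid A] [Module R A] (b : A →ₗ[R] A →ₗ[R] R) : Prop :=
  Function.Bijective fun x : A => b x

/-- The linear form `φ_G` on `RB(G)` of a family `(φ_H)` of linear forms on the `RB(H)` for the
subgroups `H` of `G`: the group `G` and its largest subgroup are identified. -/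
noncomputable def formTop (φ : ∀ H : Subgroup G, BurnsideAlgebra R H →ₗ[R] R) :
    BurnsideAlgebra R G →ₗ[R] R :=
  φ ⊤ ∘ₗ BurnsideAlgebra.res R ⊤

/-- The family `(φ_H)` is stable by induction: `φ_G(Ind_H^G X) = φ_H(X)` for all subgroups `H` of
`G` and all finite `H`-sets `X`. -/
def StableByInduction [Finite G] (φ : ∀ H : Subgroup G, BurnsideAlgebra R H →ₗ[R] R) : Prop :=
  ∀ (H : Subgroup G) (X : FinGSet H),
    formTop φ (BurnsideAlgebra.cls R (X.ind H)) = φ H (BurnsideAlgebra.cls R X)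

end Forms

end MackeySymm

/-!
The Mackey algebra is isomorphic, through `β`, to the algebra `RB(Ω²)` of diagrams `Ω ← Z → Ω`, and
there the trace form is easy to understand. For diagrams `Z` and `Y`, the Burnside trace of `Z Y` is
the `G`-set of the pairs `(z, y)` such that `z` lies over `(a, b)` and `y` lies over `(b, a)` for
some point `(a, b)` of `Ω × Ω`. In other words it is the fibre product over `Ω × Ω` of `Z` and of
the diagram `Yᵒᵖ` with exchanged legs. A `G`-set over `Ω × Ω` amounts to a family of sets with
actions of the stabilizers `S_i` of representatives `w_i` of the orbits (`SpanSemiring.fibreEquiv`),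
namely its fibres at the `w_i`, and it is recovered from them by induction. Hence
`Btr(Z Y) = ∑ᵢ Ind_{S_i}^G (Z_i × Yᵒᵖ_i)`, and for a family `φ` stable by induction
`φ_G(Btr(x y)) = ∑ᵢ φ_{S_i}(x_i yᵒᵖ_i)` (`formTop_btr_mul`). So the trace form is, up to the
invertible substitution `y ↦ yᵒᵖ`, the orthogonal sum of the forms of the `φ_{S_i}`, and it is
non-degenerate if and only if all of them are (`isNondegenerate_iff_of_eq_sum`). Every subgroup `H`
occurs among the `S_i`: the stabilizer of the point `(H, H)` of `G/H × G/H` is `H`, and the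
representatives may be chosen to contain this point.

The bijectivity of `β` is proved as follows. By the Mackey formula and the other relations, the
elements `t_A^H c_{g,B} r^K_B` span the Mackey algebra (`MackeyAlgebra.span_tcrSet`). The map `β`
sends such an element to the transitive diagram `G/H ← G/A → G/K`. Every diagram is a disjoint union
of transitive ones, so `β` is surjective. Conversely the element `t_A^H c_{g,B} r^K_B` only depends
on the isomorphism class of the diagram (`MackeyAlgebra.tcr_eq_tcr`), so summing over the orbits of
a diagram gives a well-defined linear map `RB(Ω²) → μ_R(G)` that is a left inverse of `β`.
-/

namespace MackeySymm

/-! ### A spanning family of the Mackey algebra -/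

namespace MackeyAlgebra

open scoped Classical in
/-- `t_H^K` in the Mackey algebra, with the value `0` if `H` is not contained in `K`: this total
function allows rewriting the subgroups. -/
noncomputable def transfer (R : Type v) [CommRing R] {G : Type u} [Group G] (H K : Subgroup G) :
    MackeyAlgebra G R :=
  if h : H ≤ K then RingQuot.mkAlgHom R (MackeyRel R) (genT R H K h) else 0

open scoped Classical in
/-- `r^K_H` in the Mackey algebra, with the value `0` if `H` is not contained in `K`. -/
noncomputable def restr (R : Type v) [CommRing R] {G : Type u} [Group G] (H K : Subgroup G) :
    MackeyAlgebra G R :=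
  if h : H ≤ K then RingQuot.mkAlgHom R (MackeyRel R) (genR R H K h) else 0

/-- `c_{g,H}` in the Mackey algebra. -/
noncomputable def conj (R : Type v) [CommRing R] {G : Type u} [Group G] (g : G)
    (H : Subgroup G) : MackeyAlgebra G R :=
  RingQuot.mkAlgHom R (MackeyRel R) (genC R g H)

/-- The element `t_A^H c_{g,B} r^K_B` of the Mackey algebra, where `A = ᵍB`. -/
noncomputable def tcr (R : Type v) [CommRing R] {G : Type u} [Group G] (H A : Subgroup G) (g : G)
    (K : Subgroup G) : MackeyAlgebra G R :=
  transfer R A H * conj R g (lconj g⁻¹ A) * restr R (lconj g⁻¹ A) K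

variable (R : Type v) [CommRing R] {G : Type u} [Group G]

theorem transfer_of_le {H K : Subgroup G} (h : H ≤ K) :
    transfer R H K = RingQuot.mkAlgHom R (MackeyRel R) (genT R H K h) := dif_pos h

theorem restr_of_le {H K : Subgroup G} (h : H ≤ K) :
    restr R H K = RingQuot.mkAlgHom R (MackeyRel R) (genR R H K h) := dif_pos h

theorem sum_transfer_self [Finite G] :
    ∑ᶠ H : Subgroup G, transfer R H H = (1 : MackeyAlgebra G R) := by
  have := Fintype.ofFinite (Subgroup G)
  have h := RingQuot.mkAlgHom_rel R (MackeyRel.sum_one (R := R) (G := G))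
  rw [finsum_eq_sum_of_fintype, map_sum, map_one] at h
  rw [finsum_eq_sum_of_fintype, ← h]
  exact Finset.sum_congr rfl fun H _ => transfer_of_le R le_rfl

theorem restr_self (H : Subgroup G) : restr R H H = transfer R H H := by
  rw [restr_of_le R le_rfl, transfer_of_le R le_rfl]
  exact (RingQuot.mkAlgHom_rel R (MackeyRel.t_eq_r H)).symm

theorem conj_self {H : Subgroup G} {h : G} (hh : h ∈ H) : conj R h H = transfer R H H := by
  rw [← restr_self, restr_of_le R le_rfl]
  exact (RingQuot.mkAlgHom_rel R (MackeyRel.r_eq_c H h hh)).symm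

theorem transfer_mul_transfer {H K L : Subgroup G} (hHK : H ≤ K) (hKL : K ≤ L) :
    transfer R K L * transfer R H K = transfer R H L := by
  rw [transfer_of_le R hHK, transfer_of_le R hKL, transfer_of_le R (hHK.trans hKL), ← map_mul]
  exact RingQuot.mkAlgHom_rel R (MackeyRel.t_mul_t H K L hHK hKL)

theorem restr_mul_restr {H K L : Subgroup G} (hHK : H ≤ K) (hKL : K ≤ L) :
    restr R H K * restr R K L = restr R H L := by
  rw [restr_of_le R hHK, restr_of_le R hKL, restr_of_le R (hHK.trans hKL), ← map_mul]
  exact RingQuot.mkAlgHom_rel R (MackeyRel.r_mul_r H K L hHK hKL)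

theorem conj_mul_conj (g' g : G) {L H : Subgroup G} (hL : L = lconj g H) :
    conj R g' L * conj R g H = conj R (g' * g) H := by
  subst hL
  rw [conj, conj, conj, ← map_mul]
  exact RingQuot.mkAlgHom_rel R (MackeyRel.c_mul_c g g' H)

theorem transfer_mul_conj (g : G) {H K : Subgroup G} (h : H ≤ K) :
    transfer R (lconj g H) (lconj g K) * conj R g H = conj R g K * transfer R H K := by
  rw [transfer_of_le R h, transfer_of_le R (lconj_mono g h), conj, conj, ← map_mul, ← map_mul]
  exact RingQuot.mkAlgHom_rel R (MackeyRel.t_mul_c g H K h)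

theorem restr_mul_conj (g : G) {H K : Subgroup G} (h : H ≤ K) :
    restr R (lconj g H) (lconj g K) * conj R g K = conj R g H * restr R H K := by
  rw [restr_of_le R h, restr_of_le R (lconj_mono g h), conj, conj, ← map_mul, ← map_mul]
  exact RingQuot.mkAlgHom_rel R (MackeyRel.r_mul_c g H K h)

theorem restr_mul_transfer {L H K : Subgroup G} (hL : L ≤ H) (hK : K ≤ H) {T : Finset G}
    (hT : IsDoubleCosetReps L H K T) :
    restr R L H * transfer R K H = ∑ h ∈ T, transfer R (L ⊓ lconj h K) L *
      conj R h (lconj h⁻¹ L ⊓ K) * restr R (lconj h⁻¹ L ⊓ K) K := by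
  rw [restr_of_le R hL, transfer_of_le R hK, ← map_mul,
    RingQuot.mkAlgHom_rel R (MackeyRel.mackey L H K hL hK T hT), map_sum]
  refine Finset.sum_congr rfl fun h _ => ?_
  rw [map_mul, map_mul, transfer_of_le R inf_le_left, restr_of_le R inf_le_right, conj]

theorem mk_mul_transfer_of_ne (a : MackeyGen G) {A H : Subgroup G} (hA : A ≤ H)
    (h : a.source ≠ H) :
    RingQuot.mkAlgHom R (MackeyRel R) (FreeAlgebra.ι R a) * transfer R A H = 0 := by
  rw [transfer_of_le R hA, genT, ← map_mul,
    RingQuot.mkAlgHom_rel R (MackeyRel.other a (.t A H hA) h), map_zero]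

theorem transfer_mul_conj_of_mem {H A : Subgroup G} {h : G} (hh : h ∈ H) (hA : lconj h A ≤ H) :
    transfer R (lconj h A) H * conj R h A = transfer R A H := by
  have hA' : A ≤ H := by
    rw [← inv_lconj h A, ← lconj_self (inv_mem hh)]
    exact lconj_mono _ hA
  have := transfer_mul_conj R h hA'
  rw [lconj_self hh] at this
  rw [this, conj_self R hh, transfer_mul_transfer R hA' le_rfl]

theorem conj_mul_restr_of_mem {K B : Subgroup G} {k : G} (hk : k ∈ K) (hB : B ≤ K) :
    conj R k B * restr R B K = restr R (lconj k B) K := by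
  have hB' : lconj k B ≤ K := by
    simpa only [lconj_self hk] using lconj_mono k hB
  have := restr_mul_conj R k hB
  rw [lconj_self hk] at this
  rw [← this, conj_self R hk, ← restr_self, restr_mul_restr R hB' le_rfl]

/-- The element `t_A^H c_{g,B} r^K_B` only depends on the isomorphism class of the diagram
`G/H ← G/A → G/K`: it does not change with the choice of base points. -/
theorem tcr_eq_tcr {H A K : Subgroup G} {g h k : G} (hh : h ∈ H) (hk : k ∈ K) (hA : A ≤ H)
    (hAK : A ≤ lconj g K) :
    tcr R H (lconj h⁻¹ A) (h⁻¹ * g * k) K = tcr R H A g K := by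
  have hB : lconj g⁻¹ A ≤ K := by simpa only [inv_lconj] using lconj_mono g⁻¹ hAK
  have hB' : lconj (h⁻¹ * g * k)⁻¹ (lconj h⁻¹ A) = lconj k⁻¹ (lconj g⁻¹ A) := by
    rw [lconj_lconj, lconj_lconj]
    congr 1
    group
  have h1 := transfer_mul_conj_of_mem R (A := lconj h⁻¹ A) hh (by rwa [lconj_inv])
  rw [lconj_inv] at h1
  have h2 := conj_mul_restr_of_mem R (B := lconj k⁻¹ (lconj g⁻¹ A)) hk
    (by simpa only [lconj_self (inv_mem hk)] using lconj_mono k⁻¹ hB)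
  rw [lconj_inv] at h2
  rw [tcr, tcr, hB', ← h1, ← h2, mul_assoc _ (conj R h _),
    conj_mul_conj R h (h⁻¹ * g * k) (by simp only [lconj_lconj]; congr 1; group),
    mul_assoc (transfer R A H) (conj R g _), ← mul_assoc (conj R g _),
    conj_mul_conj R g k (by rw [lconj_inv])]
  simp only [mul_assoc, mul_inv_cancel_left]

theorem exists_isDoubleCosetReps [Finite G] {L H K : Subgroup G} (hL : L ≤ H) (hK : K ≤ H) :
    ∃ T : Finset G, IsDoubleCosetReps L H K T := by
  classical
  have := Fintype.ofFinite G
  -- `f x` is a chosen representative of the double coset of `x` in the whole group `G`.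
  let f : G → G := fun x => (DoubleCoset.mk L K x).out
  have hf : ∀ x, ∃ l ∈ L, ∃ k ∈ K, x = l * f x * k := by
    intro x
    have := (DoubleCoset.eq L K (f x) x).1 (Quotient.out_eq' _)
    exact this
  have hff : ∀ x y, (∃ l ∈ L, ∃ k ∈ K, x = l * y * k) → f x = f y := by
    intro x y h
    exact congrArg Quotient.out ((DoubleCoset.eq L K y x).2 h).symm
  have hfH : ∀ x ∈ H, f x ∈ H := by
    intro x hx
    obtain ⟨l, hl, k, hk, e⟩ := hf x
    have : f x = l⁻¹ * x * k⁻¹ := by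
      conv_rhs => rw [e]
      group
    rw [this]
    exact mul_mem (mul_mem (inv_mem (hL hl)) hx) (inv_mem (hK hk))
  refine ⟨Finset.univ.filter fun t => t ∈ H ∧ f t = t,
    fun t ht => (Finset.mem_filter.1 ht).2.1, fun x hx => ?_⟩
  refine ⟨f x, ⟨Finset.mem_filter.2 ⟨Finset.mem_univ _, hfH x hx, ?_⟩, hf x⟩, ?_⟩
  · exact (hff _ _ (hf x)).symm
  · rintro t ⟨ht, h⟩
    rw [← (Finset.mem_filter.1 ht).2.2, hff _ _ h]

/-- The set of the elements `t_A^H c_{g,B} r^K_B` of the Mackey algebra. -/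
def tcrSet : Set (MackeyAlgebra G R) :=
  {a | ∃ (H A : Subgroup G) (g : G) (K : Subgroup G), A ≤ H ∧ A ≤ lconj g K ∧ a = tcr R H A g K}

theorem transfer_mul_tcr {L H A K : Subgroup G} (g : G) (hA : A ≤ H) (hL : H ≤ L) :
    transfer R H L * tcr R H A g K = tcr R L A g K := by
  rw [tcr, tcr, ← mul_assoc, ← mul_assoc, transfer_mul_transfer R hA hL]

theorem conj_mul_tcr {H A K : Subgroup G} (x g : G) (hA : A ≤ H) :
    conj R x H * tcr R H A g K = tcr R (lconj x H) (lconj x A) (x * g) K := by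
  have hB : lconj (x * g)⁻¹ (lconj x A) = lconj g⁻¹ A := by
    rw [lconj_lconj]
    congr 1
    group
  rw [tcr, tcr, hB, ← mul_assoc, ← mul_assoc, ← transfer_mul_conj R x hA,
    mul_assoc _ (conj R x A), conj_mul_conj R x g (by rw [lconj_inv])]

theorem restr_mul_tcr {L H A K : Subgroup G} (g : G) (hA : A ≤ H) (hAK : A ≤ lconj g K)
    (hL : L ≤ H) {T : Finset G} (hT : IsDoubleCosetReps L H A T) :
    restr R L H * tcr R H A g K = ∑ x ∈ T, tcr R L (L ⊓ lconj x A) (x * g) K := by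
  have hB : lconj g⁻¹ A ≤ K := by simpa only [inv_lconj] using lconj_mono g⁻¹ hAK
  rw [tcr, ← mul_assoc, ← mul_assoc, restr_mul_transfer R hL hA hT, Finset.sum_mul,
    Finset.sum_mul]
  refine Finset.sum_congr rfl fun x _ => ?_
  have h1 := restr_mul_conj R g (H := lconj g⁻¹ (lconj x⁻¹ L ⊓ A)) (K := lconj g⁻¹ A)
    (lconj_mono _ inf_le_right)
  rw [lconj_inv, lconj_inv] at h1
  have hC : lconj (x * g)⁻¹ (L ⊓ lconj x A) = lconj g⁻¹ (lconj x⁻¹ L ⊓ A) := by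
    rw [mul_inv_rev, ← lconj_lconj, lconj_inf x⁻¹, inv_lconj]
  rw [mul_assoc _ _ (conj R g _), h1, tcr, hC, ← mul_assoc, mul_assoc _ _ (conj R g _),
    conj_mul_conj R x g (by rw [lconj_inv]), mul_assoc _ _ (restr R (lconj g⁻¹ A) K),
    restr_mul_restr R (lconj_mono _ inf_le_right) hB]

/-- The Mackey algebra is spanned by the elements `t_A^H c_{g,B} r^K_B`: they contain the unit in
their span, and the span is a left ideal by the Mackey formula. -/
theorem span_tcrSet [Finite G] : Submodule.span R (tcrSet R (G := G)) = ⊤ := by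
  have hmem : ∀ {H A K : Subgroup G} {g : G}, A ≤ H → A ≤ lconj g K →
      tcr R H A g K ∈ Submodule.span R (tcrSet R (G := G)) := fun h1 h2 =>
    Submodule.subset_span ⟨_, _, _, _, h1, h2, rfl⟩
  have hgen : ∀ (a : MackeyGen G), ∀ y ∈ tcrSet R (G := G),
      RingQuot.mkAlgHom R (MackeyRel R) (FreeAlgebra.ι R a) * y ∈
        Submodule.span R (tcrSet R (G := G)) := by
    rintro a _ ⟨H, A, g, K, hA, hAK, rfl⟩
    by_cases h : a.source = H
    · subst h
      cases a with
      | t H L h =>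
        have := transfer_mul_tcr R (H := H) (K := K) g hA h
        rw [transfer_of_le R h] at this
        exact this ▸ hmem (hA.trans h) hAK
      | c x H =>
        have := conj_mul_tcr R (K := K) x g hA
        exact this ▸ hmem (lconj_mono x hA) (lconj_lconj x g K ▸ lconj_mono x hAK)
      | r L H h =>
        obtain ⟨T, hT⟩ := exists_isDoubleCosetReps h hA
        have := restr_mul_tcr R (H := H) g hA hAK h hT
        rw [restr_of_le R h] at this
        refine this ▸ Submodule.sum_mem _ fun x _ => hmem inf_le_left ?_
        exact inf_le_right.trans (lconj_lconj x g K ▸ lconj_mono x hAK)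
    · rw [tcr, ← mul_assoc, ← mul_assoc, mk_mul_transfer_of_ne R a hA h, zero_mul, zero_mul]
      exact zero_mem _
  have hfree : ∀ (a : FreeAlgebra R (MackeyGen G)), ∀ y ∈ Submodule.span R (tcrSet R (G := G)),
      RingQuot.mkAlgHom R (MackeyRel R) a * y ∈ Submodule.span R (tcrSet R (G := G)) := by
    intro a
    induction a using FreeAlgebra.induction with
    | grade0 r =>
      intro y hy
      rw [AlgHom.commutes, ← Algebra.smul_def]
      exact Submodule.smul_mem _ r hy
    | grade1 a =>
      intro y hy
      induction hy using Submodule.span_induction with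
      | mem y hy => exact hgen a y hy
      | zero => rw [mul_zero]; exact zero_mem _
      | add y z _ _ hy hz => rw [mul_add]; exact add_mem hy hz
      | smul r y _ hy => rw [mul_smul_comm]; exact Submodule.smul_mem _ r hy
    | mul a b ha hb =>
      intro y hy
      rw [map_mul, mul_assoc]
      exact ha _ (hb y hy)
    | add a b ha hb =>
      intro y hy
      rw [map_add, add_mul]
      exact add_mem (ha y hy) (hb y hy)
  have hone : (1 : MackeyAlgebra G R) ∈ Submodule.span R (tcrSet R (G := G)) := by
    have := Fintype.ofFinite (Subgroup G)
    rw [← sum_transfer_self, finsum_eq_sum_of_fintype]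
    refine Submodule.sum_mem _ fun H _ => ?_
    have h : tcr R H H 1 H = transfer R H H := by
      rw [tcr, inv_one, lconj_one, conj_self R (one_mem H), restr_self,
        transfer_mul_transfer R le_rfl le_rfl, transfer_mul_transfer R le_rfl le_rfl]
    exact h ▸ hmem le_rfl (lconj_one H).ge
  refine Submodule.eq_top_iff'.2 fun x => ?_
  obtain ⟨a, rfl⟩ := RingQuot.mkAlgHom_surjective R (MackeyRel R) x
  simpa using hfree a 1 hone

end MackeyAlgebra

/-! ### The map `β` is bijective -/

namespace Omega

variable {G : Type u} [Group G]

/-- The subgroup `L` of a point of the component `G/L` of `Ω`. -/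
def subgroup (w : Omega G) : Subgroup G := w.1

/-- A chosen representative `x` of a point `xL` of `Ω`. -/
noncomputable def base (w : Omega G) : G := Quotient.out w.2

theorem coset_subgroup_base (w : Omega G) : coset w.subgroup w.base = w :=
  congrArg (Sigma.mk w.1) (Quotient.out_eq' w.2)

theorem exists_eq_coset (w : Omega G) : ∃ (H : Subgroup G) (x : G), w = coset H x :=
  ⟨_, _, w.coset_subgroup_base.symm⟩

theorem lconj_inv_stabilizer_coset (H : Subgroup G) (x : G) :
    lconj x⁻¹ (MulAction.stabilizer G (coset H x)) = H := by
  ext g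
  rw [mem_lconj, MulAction.mem_stabilizer_iff, smul_coset, eq_comm, coset_eq]
  simp [mul_assoc]

end Omega

theorem lconj_smul_stabilizer {G : Type u} [Group G] {Z : Type*} [MulAction G Z] (g : G) (z : Z) :
    MulAction.stabilizer G (g • z) = lconj g (MulAction.stabilizer G z) :=
  MulAction.stabilizer_smul_eq_stabilizer_map_conj g z

namespace Span

variable (R : Type v) [CommRing R] {G : Type u} [Group G]

theorem lconj_stabilizer_le_left (Z : Span G (Omega G)) {z : Z.carrier} {H : Subgroup G} {x : G}
    (hl : Z.left z = Omega.coset H x) : lconj x⁻¹ (MulAction.stabilizer G z) ≤ H := by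
  rw [← Omega.lconj_inv_stabilizer_coset H x]
  refine lconj_mono _ fun g hg => ?_
  rw [MulAction.mem_stabilizer_iff] at hg ⊢
  rw [← hl, ← map_smul, hg]

theorem lconj_stabilizer_le_right (Z : Span G (Omega G)) {z : Z.carrier} {K : Subgroup G} {y : G}
    (hr : Z.right z = Omega.coset K y) (x : G) :
    lconj x⁻¹ (MulAction.stabilizer G z) ≤ lconj (x⁻¹ * y) K := by
  rw [← lconj_lconj, ← Omega.lconj_inv_stabilizer_coset K y, lconj_inv]
  refine lconj_mono _ fun g hg => ?_
  rw [MulAction.mem_stabilizer_iff] at hg ⊢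
  rw [← hr, ← map_smul, hg]

/-- The element `t_A^H c_{g,B} r^K_B` of the Mackey algebra attached to the orbit of a point `z` of
a diagram over `Ω`: if `z` lies over `(xH, yK)` and has stabilizer `S`, then `A = x⁻¹ S x` and
`g = x⁻¹ y`. -/
noncomputable def pointElt (Z : Span G (Omega G)) (z : Z.carrier) : MackeyAlgebra G R :=
  MackeyAlgebra.tcr R (Z.left z).subgroup
    (lconj (Z.left z).base⁻¹ (MulAction.stabilizer G z))
    ((Z.left z).base⁻¹ * (Z.right z).base) (Z.right z).subgroup

theorem pointElt_eq (Z : Span G (Omega G)) {z : Z.carrier} {H K : Subgroup G} {x y : G}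
    (hl : Z.left z = Omega.coset H x) (hr : Z.right z = Omega.coset K y) :
    Z.pointElt R z =
      MackeyAlgebra.tcr R H (lconj x⁻¹ (MulAction.stabilizer G z)) (x⁻¹ * y) K := by
  have hl' := (Z.left z).coset_subgroup_base
  have hr' := (Z.right z).coset_subgroup_base
  rw [pointElt]
  generalize (Z.left z).base = x' at *
  generalize (Z.right z).base = y' at *
  obtain rfl : (Z.left z).subgroup = H := Omega.eq_of_coset_eq (hl'.trans hl)
  obtain rfl : (Z.right z).subgroup = K := Omega.eq_of_coset_eq (hr'.trans hr)
  have hx := Omega.coset_eq.1 (hl.symm.trans hl'.symm)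
  have hy := Omega.coset_eq.1 (hr.symm.trans hr'.symm)
  rw [← MackeyAlgebra.tcr_eq_tcr R hx hy (Z.lconj_stabilizer_le_left hl)
    (Z.lconj_stabilizer_le_right hr x), lconj_lconj]
  congr 1
  · congr 1
    group
  · group

theorem pointElt_smul (Z : Span G (Omega G)) (g : G) (z : Z.carrier) :
    Z.pointElt R (g • z) = Z.pointElt R z := by
  obtain ⟨H, x, hl⟩ := (Z.left z).exists_eq_coset
  obtain ⟨K, y, hr⟩ := (Z.right z).exists_eq_coset
  rw [Z.pointElt_eq R hl hr, Z.pointElt_eq R (H := H) (K := K) (x := g * x) (y := g * y)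
    (by rw [map_smul, hl, Omega.smul_coset]) (by rw [map_smul, hr, Omega.smul_coset]),
    lconj_smul_stabilizer, lconj_lconj]
  congr 1
  · congr 1
    group
  · group

/-- The element of the Mackey algebra attached to an orbit of a diagram over `Ω`. -/
noncomputable def orbitElt (Z : Span G (Omega G)) (q : MulAction.orbitRel.Quotient G Z.carrier) :
    MackeyAlgebra G R :=
  Quotient.liftOn' q (Z.pointElt R) (by
    rintro _ z ⟨g, rfl⟩
    exact Z.pointElt_smul R g z)

/-- The sum over the orbits of a diagram over `Ω` of the attached elements of the Mackey algebra. -/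
noncomputable def toMackey (Z : Span G (Omega G)) : MackeyAlgebra G R :=
  ∑ᶠ q : MulAction.orbitRel.Quotient G Z.carrier, Z.orbitElt R q

theorem stabilizer_apply_equiv {Y Z : Type*} [MulAction G Y] [MulAction G Z] {e : Y → Z}
    (hi : Function.Injective e) (he : ∀ (g : G) (y : Y), e (g • y) = g • e y) (y : Y) :
    MulAction.stabilizer G (e y) = MulAction.stabilizer G y := by
  ext g
  rw [MulAction.mem_stabilizer_iff, MulAction.mem_stabilizer_iff, ← he, hi.eq_iff]

theorem pointElt_congr {Y Z : Span G (Omega G)} {e : Y.carrier → Z.carrier}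
    (hi : Function.Injective e) (he : ∀ (g : G) (y : Y.carrier), e (g • y) = g • e y)
    (hl : ∀ y, Z.left (e y) = Y.left y) (hr : ∀ y, Z.right (e y) = Y.right y) (y : Y.carrier) :
    Z.pointElt R (e y) = Y.pointElt R y := by
  rw [pointElt, pointElt, stabilizer_apply_equiv hi he, hl, hr]

theorem toMackey_congr {Y Z : Span G (Omega G)} (h : Iso Y Z) : Y.toMackey R = Z.toMackey R := by
  obtain ⟨e, he, hl, hr⟩ := h
  let f : MulAction.orbitRel.Quotient G Y.carrier ≃ MulAction.orbitRel.Quotient G Z.carrier :=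
    Quotient.congr e fun y y' => by
      change (∃ g : G, g • y' = y) ↔ (∃ g : G, g • e y' = e y)
      simp_rw [← he, e.injective.eq_iff]
  rw [toMackey, toMackey, ← finsum_comp_equiv f]
  refine finsum_congr fun q => ?_
  induction q using Quotient.inductionOn' with
  | h y => exact (pointElt_congr R e.injective he hl hr y).symm

theorem toMackey_sum (Y Z : Span G (Omega G)) :
    (Y.sum Z).toMackey R = Y.toMackey R + Z.toMackey R := by
  let f : MulAction.orbitRel.Quotient G Y.carrier ⊕ MulAction.orbitRel.Quotient G Z.carrier ≃
      MulAction.orbitRel.Quotient G (Y.sum Z).carrier :=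
    { toFun := Sum.elim
        (Quotient.map' Sum.inl (by rintro _ y ⟨g, rfl⟩; exact ⟨g, rfl⟩))
        (Quotient.map' Sum.inr (by rintro _ y ⟨g, rfl⟩; exact ⟨g, rfl⟩))
      invFun := fun q => Quotient.liftOn' q
        (Sum.map Quotient.mk'' Quotient.mk'') (by
          rintro _ (y | z) ⟨g, rfl⟩
          · exact congrArg Sum.inl (Quotient.sound' ⟨g, rfl⟩)
          · exact congrArg Sum.inr (Quotient.sound' ⟨g, rfl⟩))
      left_inv := by
        rintro (q | q) <;> induction q using Quotient.inductionOn' <;> rfl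
      right_inv := by
        intro q
        induction q using Quotient.inductionOn' with
        | h p => rcases p with y | z <;> rfl }
  have := Fintype.ofFinite (MulAction.orbitRel.Quotient G Y.carrier)
  have := Fintype.ofFinite (MulAction.orbitRel.Quotient G Z.carrier)
  rw [toMackey, toMackey, toMackey, ← finsum_comp_equiv f, finsum_eq_sum_of_fintype,
    finsum_eq_sum_of_fintype, finsum_eq_sum_of_fintype, Fintype.sum_sum_type]
  congr 1
  · refine Finset.sum_congr rfl fun q _ => ?_
    induction q using Quotient.inductionOn' with
    | h y =>
      exact pointElt_congr R (Y := Y) (Z := Y.sum Z) (e := Sum.inl) Sum.inl_injective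
        (fun _ _ => rfl) (fun _ => rfl) (fun _ => rfl) y
  · refine Finset.sum_congr rfl fun q _ => ?_
    induction q using Quotient.inductionOn' with
    | h z =>
      exact pointElt_congr R (Y := Z) (Z := Y.sum Z) (e := Sum.inr) Sum.inr_injective
        (fun _ _ => rfl) (fun _ => rfl) (fun _ => rfl) z

end Span

section

variable (R : Type v) [CommRing R] {G : Type u} [Group G]

/-- The additive map from the isomorphism classes of diagrams over `Ω` to the Mackey algebra that
inverts `β`. -/
noncomputable def SpanSemiring.toMackey : SpanSemiring G (Omega G) →+ MackeyAlgebra G R where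
  toFun := Quotient.lift (Span.toMackey R) fun _ _ h => Span.toMackey_congr R h
  map_zero' := by
    change (Span.empty G (Omega G)).toMackey R = 0
    have : IsEmpty (MulAction.orbitRel.Quotient G (Span.empty G (Omega G)).carrier) :=
      ⟨fun q => Quotient.inductionOn' q fun z => PEmpty.elim z⟩
    exact finsum_of_isEmpty _
  map_add' := by
    rintro ⟨Y⟩ ⟨Z⟩
    exact Span.toMackey_sum R Y Z

variable [Finite G]

theorem SpanSemiring.toMackey_orb {H A K : Subgroup G} {g : G} (hH : A ≤ H) (hK : A ≤ lconj g K) :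
    SpanSemiring.toMackey R (orb H A g K hH hK) = MackeyAlgebra.tcr R H A g K := by
  change ∑ᶠ q : MulAction.orbitRel.Quotient G (orbitSpan H A g K hH hK).carrier,
    (orbitSpan H A g K hH hK).orbitElt R q = _
  have : MulAction.IsPretransitive G (orbitSpan H A g K hH hK).carrier :=
    inferInstanceAs (MulAction.IsPretransitive G (G ⧸ A))
  let z : (orbitSpan H A g K hH hK).carrier := ((1 : G) : G ⧸ A)
  let _ : Unique (MulAction.orbitRel.Quotient G (orbitSpan H A g K hH hK).carrier) :=
    { default := Quotient.mk'' z
      uniq := fun q => by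
        induction q using Quotient.inductionOn' with
        | h p => exact Quotient.sound' (MulAction.exists_smul_eq G z p) }
  rw [finsum_unique]
  change (orbitSpan H A g K hH hK).pointElt R z = _
  rw [Span.pointElt_eq R _ (z := z) (H := H) (K := K) (x := 1) (y := g)]
  · have : MulAction.stabilizer G z = A := MulAction.stabilizer_quotient A
    rw [this, inv_one, lconj_one, one_mul]
  · exact congrArg (Omega.coset H) (one_mul 1)
  · exact congrArg (Omega.coset K) (one_mul g)

theorem beta_mkAlgHom (a : FreeAlgebra R (MackeyGen G)) :
    beta G R (RingQuot.mkAlgHom R (MackeyRel R) a) = betaFree R a :=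
  RingQuot.liftAlgHom_mkAlgHom_apply R _ _ a

theorem beta_tcr {H A K : Subgroup G} {g : G} (hH : A ≤ H) (hK : A ≤ lconj g K) :
    beta G R (MackeyAlgebra.tcr R H A g K) = 1 ⊗ₜ[ℕ] orb H A g K hH hK := by
  have hB : lconj g⁻¹ A ≤ K := by simpa only [inv_lconj] using lconj_mono g⁻¹ hK
  rw [MackeyAlgebra.tcr, MackeyAlgebra.transfer_of_le R hH, MackeyAlgebra.restr_of_le R hB,
    MackeyAlgebra.conj, map_mul, map_mul, beta_mkAlgHom, beta_mkAlgHom, beta_mkAlgHom,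
    betaFree_t, betaFree_c, betaFree_r, Algebra.TensorProduct.tmul_mul_tmul,
    Algebra.TensorProduct.tmul_mul_tmul, mul_one, mul_one,
    orb_mackey g (lconj g⁻¹ A) hB A H (lconj_inv g A).symm hH]

theorem beta_injective : Function.Injective (beta G R) := by
  let γ : SpanAlgebra R G (Omega G) →ₗ[R] MackeyAlgebra G R :=
    (SpanSemiring.toMackey R).toNatLinearMap.liftBaseChange R
  have h : γ ∘ₗ (beta G R).toLinearMap = LinearMap.id := by
    refine LinearMap.ext_on (MackeyAlgebra.span_tcrSet R) ?_
    rintro _ ⟨H, A, g, K, hH, hK, rfl⟩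
    change γ (beta G R (MackeyAlgebra.tcr R H A g K)) = MackeyAlgebra.tcr R H A g K
    rw [beta_tcr R hH hK, ← SpanSemiring.toMackey_orb R hH hK]
    exact (LinearMap.liftBaseChange_tmul _ _ _ _).trans (one_smul R _)
  exact Function.LeftInverse.injective (g := γ) fun x => LinearMap.congr_fun h x

/-- Every diagram over `Ω` is a disjoint union of transitive ones. -/
theorem SpanSemiring.mk_mem_closure_orb (Z : Span G (Omega G)) :
    SpanSemiring.mk Z ∈ AddSubmonoid.closure
      {a | ∃ (H A : Subgroup G) (g : G) (K : Subgroup G) (hH : A ≤ H) (hK : A ≤ lconj g K),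
        a = orb H A g K hH hK} := by
  classical
  have h : ∀ q : MulAction.orbitRel.Quotient G Z.carrier, ∃ (z : Z.carrier) (H K : Subgroup G)
      (g : G), Quotient.mk'' z = q ∧ Z.left z = Omega.coset H 1 ∧ Z.right z = Omega.coset K g := by
    intro q
    induction q using Quotient.inductionOn' with
    | h z =>
      obtain ⟨H, x, hl⟩ := (Z.left z).exists_eq_coset
      obtain ⟨K, y, hr⟩ := (Z.right z).exists_eq_coset
      refine ⟨x⁻¹ • z, H, K, x⁻¹ * y, Quotient.sound' ⟨x⁻¹, rfl⟩, ?_, ?_⟩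
      · rw [map_smul, hl, Omega.smul_coset, inv_mul_cancel]
      · rw [map_smul, hr, Omega.smul_coset]
  choose z H K g hz hl hr using h
  have hA : ∀ q, MulAction.stabilizer G (z q) ≤ H q := fun q => by
    simpa only [inv_one, lconj_one] using Z.lconj_stabilizer_le_left (hl q)
  have hK : ∀ q, MulAction.stabilizer G (z q) ≤ lconj (g q) (K q) := fun q => by
    simpa only [inv_one, lconj_one, one_mul] using Z.lconj_stabilizer_le_right (hr q) 1
  let F : MulAction.orbitRel.Quotient G Z.carrier → Span G (Omega G) := fun q =>
    orbitSpan (H q) (MulAction.stabilizer G (z q)) (g q) (K q) (hA q) (hK q)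
  have := Fintype.ofFinite (MulAction.orbitRel.Quotient G Z.carrier)
  have key : SpanSemiring.mk Z = ∑ q, SpanSemiring.mk (F q) := by
    symm
    rw [SpanSemiring.sum_mk, SpanSemiring.mk_eq]
    let f : (Σ q : (Finset.univ : Finset (MulAction.orbitRel.Quotient G Z.carrier)),
        G ⧸ MulAction.stabilizer G (z q)) → Z.carrier :=
      fun p => MulAction.ofQuotientStabilizer G (z p.1) p.2
    have hf : Function.Bijective f := by
      constructor
      · rintro ⟨⟨q, hq⟩, a⟩ ⟨⟨q', hq'⟩, a'⟩ h
        have e : q = q' := by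
          induction a using QuotientGroup.induction_on with
          | H a =>
          induction a' using QuotientGroup.induction_on with
          | H a' =>
            rw [← hz q, ← hz q']
            refine Quotient.sound' ⟨a⁻¹ * a', ?_⟩
            have h' : a • z q = a' • z q' := h
            change (a⁻¹ * a') • z q' = z q
            rw [mul_smul, ← h', inv_smul_smul]
        subst e
        exact congrArg (Sigma.mk _) (MulAction.injective_ofQuotientStabilizer G (z q) h)
      · intro w
        obtain ⟨a, ha⟩ := Quotient.exact' (hz (Quotient.mk'' w)).symm
        exact ⟨⟨⟨Quotient.mk'' w, Finset.mem_univ _⟩,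
          ((a : G) : G ⧸ MulAction.stabilizer G (z (Quotient.mk'' w)))⟩, ha⟩
    refine ⟨Equiv.ofBijective f hf, ?_, ?_, ?_⟩
    · rintro m ⟨q, a⟩
      exact MulAction.ofQuotientStabilizer_smul G (z q) m a
    · rintro ⟨q, a⟩
      induction a using QuotientGroup.induction_on with
      | H a =>
        change Z.left (a • z q) = Omega.coset (H q) (a * 1)
        rw [map_smul, hl, Omega.smul_coset]
    · rintro ⟨q, a⟩
      induction a using QuotientGroup.induction_on with
      | H a =>
        change Z.right (a • z q) = Omega.coset (K q) (a * g q)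
        rw [map_smul, hr, Omega.smul_coset]
  rw [key]
  exact sum_mem fun q _ => AddSubmonoid.subset_closure ⟨_, _, _, _, hA q, hK q, rfl⟩

theorem beta_surjective : Function.Surjective (beta G R) := by
  have h1 : ∀ Z : SpanSemiring G (Omega G),
      (1 : R) ⊗ₜ[ℕ] Z ∈ LinearMap.range (beta G R).toLinearMap := by
    rintro ⟨Z⟩
    have hZ := SpanSemiring.mk_mem_closure_orb Z
    change (1 : R) ⊗ₜ[ℕ] SpanSemiring.mk Z ∈ _
    generalize SpanSemiring.mk Z = s at hZ ⊢
    induction hZ using AddSubmonoid.closure_induction with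
    | mem a ha =>
      obtain ⟨H, A, g, K, hH, hK, rfl⟩ := ha
      exact ⟨_, beta_tcr R hH hK⟩
    | zero => rw [TensorProduct.tmul_zero]; exact zero_mem _
    | add a b _ _ ha hb => rw [TensorProduct.tmul_add]; exact add_mem ha hb
  intro x
  change x ∈ LinearMap.range (beta G R).toLinearMap
  induction x using TensorProduct.induction_on with
  | zero => exact zero_mem _
  | tmul r Z =>
    have : r ⊗ₜ[ℕ] Z = r • ((1 : R) ⊗ₜ[ℕ] Z) := by
      rw [TensorProduct.smul_tmul', smul_eq_mul, mul_one]
    rw [this]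
    exact Submodule.smul_mem _ r (h1 Z)
  | add x y hx hy => exact add_mem hx hy

end

/-! ### Diagrams as families of sets over the stabilizers -/

namespace Span

variable {G : Type u} [Group G] {X : Type u} [MulAction G X]

/-- The pair of legs `Z → X × X`. -/
def legs (Z : Span G X) (z : Z.carrier) : X × X := (Z.left z, Z.right z)

theorem legs_smul (Z : Span G X) (g : G) (z : Z.carrier) : Z.legs (g • z) = g • Z.legs z :=
  Prod.ext (map_smul Z.left g z) (map_smul Z.right g z)

/-- The fibre of a diagram `X ← Z → X` over a point `a` of `X × X`, a set with an action of the
stabilizer of `a`. -/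
def fibre (Z : Span G X) (a : X × X) : FinGSet (MulAction.stabilizer G a) where
  carrier := {z : Z.carrier // Z.legs z = a}
  act :=
    { smul := fun g z => ⟨(g : G) • z.1, by
        rw [legs_smul, z.2]
        exact g.2⟩
      one_smul := fun z => Subtype.ext (one_smul G z.1)
      mul_smul := fun g h z => Subtype.ext (mul_smul (g : G) (h : G) z.1) }

/-- The diagram obtained by exchanging the two legs. -/
def op (Z : Span G X) : Span G X where
  carrier := Z.carrier
  left := Z.right
  right := Z.left

/-- The finite `G`-set `{(z, y) | left z = right y, right z = left y}`, as a diagram over `X × X` by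
means of the legs of `z`. -/
def pairing (Z Y : Span G X) : Span G X where
  carrier := (Z.comp Y).fixedLocus.carrier
  left := ⟨fun p => Z.left p.1.1.1, fun g p => map_smul Z.left g p.1.1.1⟩
  right := ⟨fun p => Z.right p.1.1.1, fun g p => map_smul Z.right g p.1.1.1⟩

theorem fibre_pairing (Z Y : Span G X) (a : X × X) :
    FinGSet.Iso ((Z.pairing Y).fibre a) ((Z.fibre a).prod (Y.op.fibre a)) :=
  ⟨{  toFun := fun p => (⟨p.1.1.1.1, p.2⟩, ⟨p.1.1.1.2, by
        refine Eq.trans (Prod.ext ?_ ?_) p.2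
        · exact p.1.2.symm
        · exact p.1.1.2.symm⟩)
      invFun := fun p => ⟨⟨⟨(p.1.1, p.2.1),
        (congrArg Prod.snd p.1.2).trans (congrArg Prod.snd p.2.2).symm⟩,
        (congrArg Prod.fst p.1.2).trans (congrArg Prod.fst p.2.2).symm⟩, p.1.2⟩
      left_inv := fun _ => rfl
      right_inv := fun _ => rfl }, fun _ _ => rfl⟩

variable [Finite G]

/-- The map `G ×_S Y → X` given by `(g, y) ↦ g x`, for a point `x` of `X` fixed by `S`. -/
def indLeg {S : Subgroup G} (x : X) (hx : ∀ s ∈ S, s • x = x) (Y : FinGSet S) :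
    (Y.ind S).carrier →[G] X where
  toFun := Quotient.lift (fun p => p.1 • x) (by
    rintro p q ⟨h, h1, -⟩
    rw [h1, mul_smul, hx _ (inv_mem h.2)])
  map_smul' := by
    rintro g ⟨p⟩
    exact mul_smul g p.1 x

/-- The diagram `X ← G ×_S Y → X` with the legs `(g, y) ↦ g a₁` and `(g, y) ↦ g a₂`, for a set `Y`
with an action of the stabilizer `S` of `a = (a₁, a₂)`. -/
def ind (a : X × X) (Y : FinGSet (MulAction.stabilizer G a)) : Span G X where
  carrier := (Y.ind _).carrier
  left := indLeg a.1 (fun _ hs => congrArg Prod.fst hs) Y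
  right := indLeg a.2 (fun _ hs => congrArg Prod.snd hs) Y

theorem fibre_ind (a : X × X) (Y : FinGSet (MulAction.stabilizer G a)) :
    FinGSet.Iso Y ((ind a Y).fibre a) := by
  let f : Y.carrier → ((ind a Y).fibre a).carrier := fun y =>
    ⟨Quotient.mk _ (1, y), Prod.ext (one_smul G a.1) (one_smul G a.2)⟩
  have hf : Function.Bijective f := by
    constructor
    · intro y y' h
      obtain ⟨h, h1, h2⟩ := Quotient.exact (congrArg Subtype.val h)
      have : h = 1 := by
        refine Subtype.ext ?_
        simpa using h1.symm
      rw [this, one_smul] at h2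
      exact h2.symm
    · rintro ⟨⟨g, y⟩, h⟩
      have hg : g ∈ MulAction.stabilizer G a := h
      refine ⟨(⟨g, hg⟩ : MulAction.stabilizer G a) • y, Subtype.ext (Quotient.sound ?_)⟩
      refine ⟨(⟨g, hg⟩ : MulAction.stabilizer G a)⁻¹, ?_, ?_⟩
      · simp
      · simp
  refine ⟨Equiv.ofBijective f hf, fun s y => Subtype.ext (Quotient.sound ?_)⟩
  exact ⟨s⁻¹, by simp, by simp⟩

theorem isEmpty_fibre_ind {a b : X × X} (h : ∀ g : G, g • a ≠ b)
    (Y : FinGSet (MulAction.stabilizer G a)) : IsEmpty ((ind a Y).fibre b).carrier :=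
  ⟨by rintro ⟨⟨g, y⟩, e⟩; exact h g e⟩

/-- A diagram is the disjoint union of the diagrams induced from its fibres over representatives
of the orbits of `X × X`. -/
theorem iso_sigma_ind [Finite X] {w : MulAction.orbitRel.Quotient G (X × X) → X × X}
    (hw : ∀ i, Quotient.mk'' (w i) = i)
    (T : Finset (MulAction.orbitRel.Quotient G (X × X))) (hT : ∀ i, i ∈ T) (Z : Span G X) :
    Iso (sigma fun i : T => ind (w i) (Z.fibre (w i))) Z := by
  let f : (Σ i : T, (ind (w i) (Z.fibre (w i))).carrier) → Z.carrier := fun p =>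
    Quotient.lift (fun q : G × (Z.fibre (w p.1)).carrier => q.1 • q.2.1) (by
      rintro q r ⟨h, h1, h2⟩
      rw [h1, h2]
      change _ = (q.1 * (h : G)⁻¹) • (h : G) • q.2.1
      rw [mul_smul, inv_smul_smul]) p.2
  have hlegs : ∀ (i : T) (g : G) (z : (Z.fibre (w i)).carrier),
      Z.legs (g • z.1) = g • w i := fun i g z => by rw [legs_smul, z.2]
  have hf : Function.Bijective f := by
    constructor
    · rintro ⟨⟨i, hi⟩, ⟨g, z⟩⟩ ⟨⟨j, hj⟩, ⟨k, y⟩⟩ h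
      have h0 : g • z.1 = k • y.1 := h
      have h1 : g • w i = k • w j := by
        rw [← hlegs ⟨i, hi⟩ g z, ← hlegs ⟨j, hj⟩ k y, h0]
      have e : i = j := by
        rw [← hw i, ← hw j]
        refine Quotient.sound' ⟨g⁻¹ * k, ?_⟩
        change (g⁻¹ * k) • w j = w i
        rw [mul_smul, ← h1, inv_smul_smul]
      subst e
      refine congrArg (Sigma.mk _) (Quotient.sound ?_)
      have hs : k⁻¹ * g ∈ MulAction.stabilizer G (w i) := by
        rw [MulAction.mem_stabilizer_iff, mul_smul, h1, inv_smul_smul]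
      refine ⟨⟨k⁻¹ * g, hs⟩, by simp, Subtype.ext ?_⟩
      change y.1 = (k⁻¹ * g) • z.1
      rw [mul_smul, h0, inv_smul_smul]
    · intro z
      obtain ⟨g, hg⟩ := Quotient.exact' (hw (Quotient.mk'' (Z.legs z))).symm
      have hg' : g • w (Quotient.mk'' (Z.legs z)) = Z.legs z := hg
      refine ⟨⟨⟨Quotient.mk'' (Z.legs z), hT _⟩, Quotient.mk _ (g, ⟨g⁻¹ • z, ?_⟩)⟩, ?_⟩
      · exact (Z.legs_smul _ _).trans (inv_smul_eq_iff.2 hg'.symm)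
      · exact smul_inv_smul g z
  refine ⟨Equiv.ofBijective f hf, ?_, ?_, ?_⟩
  · rintro m ⟨i, ⟨g, z⟩⟩
    exact mul_smul m g z.1
  · rintro ⟨i, ⟨g, z⟩⟩
    exact congrArg Prod.fst (hlegs i g z)
  · rintro ⟨i, ⟨g, z⟩⟩
    exact congrArg Prod.snd (hlegs i g z)

end Span

namespace SpanSemiring

variable {G : Type u} [Group G] {X : Type u} [MulAction G X]

/-- The fibre over a point of `X × X`, on isomorphism classes. -/
def fibre (a : X × X) : SpanSemiring G X →+ BurnsideSemiring (MulAction.stabilizer G a) where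
  toFun := Quotient.map (fun Z => Z.fibre a) (by
    rintro Y Z ⟨e, he, hl, hr⟩
    have h : ∀ y, Z.legs (e y) = Y.legs y := fun y => Prod.ext (hl y) (hr y)
    exact ⟨Equiv.subtypeEquiv e (fun y => by rw [h]), fun g y => Subtype.ext (he g y.1)⟩)
  map_zero' := by
    have : IsEmpty ((Span.empty G X).fibre a).carrier := ⟨fun p => PEmpty.elim p.1⟩
    have : IsEmpty (FinGSet.empty (MulAction.stabilizer G a)).carrier := ⟨fun p => PEmpty.elim p⟩
    exact BurnsideSemiring.mk_eq.2 ⟨Equiv.equivOfIsEmpty _ _, fun _ p => isEmptyElim p⟩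
  map_add' := by
    rintro ⟨Y⟩ ⟨Z⟩
    refine BurnsideSemiring.mk_eq.2 ⟨
      { toFun := fun p => match p with
          | ⟨Sum.inl y, h⟩ => Sum.inl ⟨y, h⟩
          | ⟨Sum.inr y, h⟩ => Sum.inr ⟨y, h⟩
        invFun := fun p => match p with
          | Sum.inl p => ⟨Sum.inl p.1, p.2⟩
          | Sum.inr p => ⟨Sum.inr p.1, p.2⟩
        left_inv := by rintro ⟨y | y, h⟩ <;> rfl
        right_inv := by rintro (p | p) <;> rfl }, ?_⟩
    rintro g ⟨y | y, h⟩ <;> rfl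

/-- The exchange of the legs, on isomorphism classes. -/
def op : SpanSemiring G X ≃+ SpanSemiring G X where
  toFun := Quotient.map Span.op (by
    rintro Y Z ⟨e, he, hl, hr⟩
    exact ⟨e, he, hr, hl⟩)
  invFun := Quotient.map Span.op (by
    rintro Y Z ⟨e, he, hl, hr⟩
    exact ⟨e, he, hr, hl⟩)
  left_inv := by rintro ⟨Z⟩; rfl
  right_inv := by rintro ⟨Z⟩; rfl
  map_add' := by
    rintro ⟨Y⟩ ⟨Z⟩
    refine mk_eq.2 ⟨Equiv.refl _, fun _ _ => rfl, ?_, ?_⟩ <;> rintro (y | z) <;> rfl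

/-- The underlying `G`-set of a diagram, on isomorphism classes. -/
def total : SpanSemiring G X →+ BurnsideSemiring G where
  toFun := Quotient.map (fun Z => ⟨Z.carrier⟩) (by
    rintro Y Z ⟨e, he, -, -⟩
    exact ⟨e, he⟩)
  map_zero' := BurnsideSemiring.mk_eq.2 ⟨Equiv.refl PEmpty, fun _ x => PEmpty.elim x⟩
  map_add' := by
    rintro ⟨Y⟩ ⟨Z⟩
    exact BurnsideSemiring.mk_eq.2 ⟨Equiv.refl _, by rintro g (y | z) <;> rfl⟩

variable [Finite G] [Finite X]

theorem sum_mk_ind_fibre [Fintype (MulAction.orbitRel.Quotient G (X × X))]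
    {w : MulAction.orbitRel.Quotient G (X × X) → X × X} (hw : ∀ i, Quotient.mk'' (w i) = i)
    (Z : Span G X) : ∑ i, mk (Span.ind (w i) (Z.fibre (w i))) = mk Z := by
  rw [sum_mk, mk_eq]
  exact Span.iso_sigma_ind hw Finset.univ Finset.mem_univ Z

/-- The Burnside trace of a product is a sum of `G`-sets induced from the stabilizers. -/
theorem btr_mul [Fintype (MulAction.orbitRel.Quotient G (X × X))]
    {w : MulAction.orbitRel.Quotient G (X × X) → X × X} (hw : ∀ i, Quotient.mk'' (w i) = i)
    (Z Y : Span G X) :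
    btr (mk Z * mk Y) = ∑ i, BurnsideSemiring.mk (((Z.pairing Y).fibre (w i)).ind _) := by
  change total (mk (Z.pairing Y)) = _
  rw [← sum_mk_ind_fibre hw, map_sum]
  rfl

/-- A diagram over `X × X` amounts to a family of sets with actions of the stabilizers of
representatives of the orbits of `X × X`. -/
noncomputable def fibreEquiv {w : MulAction.orbitRel.Quotient G (X × X) → X × X}
    (hw : ∀ i, Quotient.mk'' (w i) = i) :
    SpanSemiring G X ≃+ ∀ i, BurnsideSemiring (MulAction.stabilizer G (w i)) :=
  AddEquiv.ofBijective (AddMonoidHom.pi fun i => fibre (w i)) <| by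
    classical
    have := Fintype.ofFinite (MulAction.orbitRel.Quotient G (X × X))
    constructor
    · rintro ⟨Y⟩ ⟨Z⟩ h
      have h' : ∀ i, FinGSet.Iso (Y.fibre (w i)) (Z.fibre (w i)) := fun i =>
        BurnsideSemiring.mk_eq.1 (congrFun h i)
      change mk Y = mk Z
      rw [← sum_mk_ind_fibre hw, ← sum_mk_ind_fibre hw Z]
      refine Finset.sum_congr rfl fun i _ => mk_eq.2 ?_
      obtain ⟨e, he⟩ := h' i
      refine ⟨Quotient.congr (Equiv.prodCongr (Equiv.refl G) e) ?_, ?_, ?_, ?_⟩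
      · rintro ⟨g, y⟩ ⟨k, z⟩
        refine exists_congr fun s => and_congr Iff.rfl ?_
        change z = s • y ↔ e z = s • e y
        rw [← he, e.injective.eq_iff]
      · rintro g ⟨p⟩
        rfl
      · rintro ⟨p⟩
        rfl
      · rintro ⟨p⟩
        rfl
    · intro y
      have hy : ∀ i, BurnsideSemiring.mk (y i).out = y i := fun i => Quotient.out_eq _
      refine ⟨∑ i, mk (Span.ind (w i) (y i).out), funext fun j => ?_⟩
      change fibre (w j) _ = y j
      rw [map_sum, Finset.sum_eq_single j]
      · exact (BurnsideSemiring.mk_eq.2 (Span.fibre_ind (w j) (y j).out)).symm.trans (hy j)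
      · intro i _ hij
        have : ∀ g : G, g • w i ≠ w j := fun g h => hij <| by
          rw [← hw i, ← hw j]
          exact (Quotient.sound' (s₁ := MulAction.orbitRel G (X × X)) ⟨g, h⟩).symm
        have : IsEmpty ((Span.ind (w i) (y i).out).fibre (w j)).carrier :=
          Span.isEmpty_fibre_ind this _
        have : IsEmpty (FinGSet.empty (MulAction.stabilizer G (w j))).carrier :=
          ⟨fun p => PEmpty.elim p⟩
        exact BurnsideSemiring.mk_eq.2 ⟨Equiv.equivOfIsEmpty _ _, fun _ p => isEmptyElim p⟩
      · exact fun h => absurd (Finset.mem_univ j) h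

end SpanSemiring

/-! ### Sums of bilinear forms -/

theorem bijective_piMap_iff {ι : Type*} {α β : ι → Type*} [∀ i, Nonempty (α i)]
    {f : ∀ i, α i → β i} :
    Function.Bijective (Pi.map f) ↔ ∀ i, Function.Bijective (f i) := by
  classical
  refine ⟨fun h i => ⟨fun x y hxy => ?_, fun b => ?_⟩, Function.Bijective.piMap⟩
  · let z : ∀ j, α j := fun j => Classical.arbitrary _
    have : Function.update z i x = Function.update z i y := h.1 <| funext fun j => by
      by_cases hj : j = i
      · subst hj
        simpa [Pi.map] using hxy
      · simp [Pi.map, hj]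
    simpa using congrFun this i
  · have : ∀ j, Nonempty (β j) := fun j => ⟨f j (Classical.arbitrary _)⟩
    obtain ⟨x, hx⟩ := h.2 (Function.update (fun j => Classical.arbitrary _) i b)
    exact ⟨x i, by simpa [Pi.map] using congrFun hx i⟩

/-- A bilinear form that is, in suitable coordinates for each of the two arguments, an orthogonal
sum of bilinear forms is non-degenerate if and only if all the summands are. -/
theorem isNondegenerate_iff_of_eq_sum {R : Type*} [CommRing R] {A : Type*} [AddCommMonoid A]
    [Module R A] {ι : Type*} [Fintype ι] {C : ι → Type*} [∀ i, AddCommMonoid (C i)]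
    [∀ i, Module R (C i)] (e e' : A ≃ₗ[R] ∀ i, C i) (b : A →ₗ[R] A →ₗ[R] R)
    (c : ∀ i, C i →ₗ[R] C i →ₗ[R] R) (h : ∀ x y, b x y = ∑ i, c i (e x i) (e' y i)) :
    IsNondegenerate b ↔ ∀ i, IsNondegenerate (c i) := by
  classical
  have hb : (fun x => b x) = (e'.dualMap ∘ LinearMap.lsum R C R) ∘
      Pi.map (fun i x => c i x) ∘ e := by
    funext x
    refine LinearMap.ext fun y => ?_
    simp [h]
  have hd : Function.Bijective (e'.dualMap ∘ LinearMap.lsum R C R) :=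
    e'.dualMap.bijective.comp (LinearMap.lsum R C R).bijective
  rw [IsNondegenerate, hb, hd.of_comp_iff', Function.Bijective.of_comp_iff _ e.bijective,
    bijective_piMap_iff]
  rfl

/-! ### The trace form in terms of the stabilizers -/

section

variable (R : Type v) [CommRing R] {G : Type u} [Group G] {X : Type u} [MulAction G X]
  [Finite X]

variable (G X) in
/-- The exchange of the legs on `RB(X²)`. -/
noncomputable def SpanAlgebra.op : SpanAlgebra R G X ≃ₗ[R] SpanAlgebra R G X :=
  LinearEquiv.baseChange ℕ R _ _ (SpanSemiring.op (G := G) (X := X)).toNatLinearEquiv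

theorem SpanAlgebra.op_tmul (r : R) (Z : Span G X) :
    SpanAlgebra.op R G X (r ⊗ₜ SpanSemiring.mk Z) = r ⊗ₜ SpanSemiring.mk Z.op := rfl

variable [Finite G]

open scoped Classical in
/-- The decomposition of `RB(X²)` into the Burnside algebras of the stabilizers of representatives
of the orbits of `X × X`. -/
noncomputable def SpanAlgebra.fibreEquiv [Fintype (MulAction.orbitRel.Quotient G (X × X))]
    {w : MulAction.orbitRel.Quotient G (X × X) → X × X} (hw : ∀ i, Quotient.mk'' (w i) = i) :
    SpanAlgebra R G X ≃ₗ[R] ∀ i, BurnsideAlgebra R (MulAction.stabilizer G (w i)) :=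
  (LinearEquiv.baseChange ℕ R _ _ (SpanSemiring.fibreEquiv hw).toNatLinearEquiv).trans
    (TensorProduct.piRight ℕ R R fun i => BurnsideSemiring (MulAction.stabilizer G (w i)))

theorem SpanAlgebra.fibreEquiv_tmul [Fintype (MulAction.orbitRel.Quotient G (X × X))]
    {w : MulAction.orbitRel.Quotient G (X × X) → X × X} (hw : ∀ i, Quotient.mk'' (w i) = i)
    (r : R) (Z : Span G X) (i : MulAction.orbitRel.Quotient G (X × X)) :
    SpanAlgebra.fibreEquiv R hw (r ⊗ₜ SpanSemiring.mk Z) i =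
      r ⊗ₜ BurnsideSemiring.mk (Z.fibre (w i)) := rfl

variable {R}

/-- For a family of linear forms stable by induction, the form given by the Burnside trace is the
sum of the forms on the Burnside algebras of the stabilizers, up to the exchange of the legs in the
second argument. -/
theorem formTop_btr_mul [Fintype (MulAction.orbitRel.Quotient G (X × X))]
    {w : MulAction.orbitRel.Quotient G (X × X) → X × X} (hw : ∀ i, Quotient.mk'' (w i) = i)
    {φ : ∀ H : Subgroup G, BurnsideAlgebra R H →ₗ[R] R} (hφ : StableByInduction φ)
    (x y : SpanAlgebra R G X) :
    formTop φ (SpanAlgebra.btr R G X (x * y)) =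
      ∑ i, φ _ (SpanAlgebra.fibreEquiv R hw x i *
        SpanAlgebra.fibreEquiv R hw (SpanAlgebra.op R G X y) i) := by
  induction x using TensorProduct.induction_on with
  | zero => simp
  | add x x' hx hx' => simp only [add_mul, map_add, hx, hx', Pi.add_apply, Finset.sum_add_distrib]
  | tmul r Z =>
    induction y using TensorProduct.induction_on with
    | zero => simp
    | add y y' hy hy' =>
      simp only [mul_add, map_add, hy, hy', Pi.add_apply, Finset.sum_add_distrib]
    | tmul s Y =>
      induction Z using Quotient.inductionOn with
      | h Z =>
      induction Y using Quotient.inductionOn with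
      | h Y =>
        change formTop φ (SpanAlgebra.btr R G X
          ((r ⊗ₜ SpanSemiring.mk Z) * (s ⊗ₜ SpanSemiring.mk Y))) = ∑ i, φ _
            (SpanAlgebra.fibreEquiv R hw (r ⊗ₜ SpanSemiring.mk Z) i *
              SpanAlgebra.fibreEquiv R hw (SpanAlgebra.op R G X (s ⊗ₜ SpanSemiring.mk Y)) i)
        have hsmul : ∀ (H : Subgroup G) (a : BurnsideSemiring H),
            (r * s) ⊗ₜ[ℕ] a = (r * s) • ((1 : R) ⊗ₜ[ℕ] a) := fun H a => by
          rw [TensorProduct.smul_tmul', smul_eq_mul, mul_one]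
        have hbtr : SpanAlgebra.btr R G X ((r * s) ⊗ₜ (SpanSemiring.mk Z * SpanSemiring.mk Y)) =
            (r * s) • ∑ i, BurnsideAlgebra.cls R (((Z.pairing Y).fibre (w i)).ind _) := by
          change (r * s) ⊗ₜ[ℕ] (SpanSemiring.btr (SpanSemiring.mk Z * SpanSemiring.mk Y)) = _
          rw [SpanSemiring.btr_mul hw, TensorProduct.tmul_sum, Finset.smul_sum]
          refine Finset.sum_congr rfl fun i _ => ?_
          rw [BurnsideAlgebra.cls, TensorProduct.smul_tmul', smul_eq_mul, mul_one]
        rw [Algebra.TensorProduct.tmul_mul_tmul, hbtr, map_smul, map_sum, Finset.smul_sum]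
        refine Finset.sum_congr rfl fun i _ => ?_
        rw [hφ, SpanAlgebra.op_tmul, SpanAlgebra.fibreEquiv_tmul, SpanAlgebra.fibreEquiv_tmul,
          Algebra.TensorProduct.tmul_mul_tmul, hsmul, map_smul, BurnsideSemiring.mk_mul,
          ← BurnsideSemiring.mk_eq.2 (Span.fibre_pairing Z Y (w i))]
        rfl

end

end MackeySymm

/-- Non-degeneracy of the form on the Mackey algebra given by the Burnside trace and a stable by
induction family of linear forms. -/
theorem theorem1p23 {G : Type u} [Group G] [Finite G] {R : Type v} [CommRing R]
    (φ : ∀ H : Subgroup G, MackeySymm.BurnsideAlgebra R H →ₗ[R] R)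
    (hφ : MackeySymm.StableByInduction φ) :
    MackeySymm.IsNondegenerate
        (MackeySymm.traceForm (MackeySymm.formTop φ ∘ₗ MackeySymm.mackeyBtr G R)) ↔
      ∀ H : Subgroup G, MackeySymm.IsNondegenerate (MackeySymm.traceForm (φ H)) := by
  open MackeySymm in
  classical
  have := Fintype.ofFinite (MulAction.orbitRel.Quotient G (Omega G × Omega G))
  let β : MackeyAlgebra G R ≃ₗ[R] SpanAlgebra R G (Omega G) :=
    LinearEquiv.ofBijective (beta G R).toLinearMap ⟨beta_injective R, beta_surjective R⟩
  have key : ∀ {w : MulAction.orbitRel.Quotient G (Omega G × Omega G) → Omega G × Omega G},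
      (∀ i, Quotient.mk'' (w i) = i) → (IsNondegenerate (traceForm (formTop φ ∘ₗ mackeyBtr G R)) ↔
        ∀ i, IsNondegenerate (traceForm (φ (MulAction.stabilizer G (w i))))) := fun hw =>
    isNondegenerate_iff_of_eq_sum (β.trans (SpanAlgebra.fibreEquiv R hw))
      (β.trans ((SpanAlgebra.op R G (Omega G)).trans (SpanAlgebra.fibreEquiv R hw))) _ _
      fun x y => by
        refine Eq.trans ?_ (formTop_btr_mul hw hφ (β x) (β y))
        exact congrArg (fun z => formTop φ (SpanAlgebra.btr R G (Omega G) z))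
          (map_mul (beta G R) x y)
  constructor
  · intro h H
    -- The representatives are chosen such that the point `(H, H)`, with stabilizer `H`, is one of
    -- them, which avoids any comparison of conjugate stabilizers.
    let a : Omega G × Omega G := (Omega.coset H 1, Omega.coset H 1)
    let i : MulAction.orbitRel.Quotient G (Omega G × Omega G) := Quotient.mk'' a
    have hw : ∀ j, (Quotient.mk'' (Function.update Quotient.out i a j) :
        MulAction.orbitRel.Quotient G (Omega G × Omega G)) = j := fun j => by
      by_cases hj : j = i
      · subst hj
        rw [Function.update_self]
      · rw [Function.update_of_ne hj]
        exact Quotient.out_eq' j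
    have hS : MulAction.stabilizer G (Function.update Quotient.out i a i) = H := by
      rw [Function.update_self]
      ext g
      rw [MulAction.mem_stabilizer_iff]
      have : g • a = a ↔ Omega.coset H 1 = Omega.coset H (g * 1) := by
        rw [eq_comm, Prod.ext_iff]
        exact and_self_iff
      rw [this, Omega.coset_eq]
      simp
    have := (key hw).1 h i
    rwa [hS] at this
  · intro h
    exact (key (w := Quotient.out) fun i => Quotient.out_eq' i).2 fun i => h _
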